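/- A Type $\mathcal A$ model is a connection $\nabla$ on $\mathbb R^2$, possibly with torsion, given by $\nabla_{\partial_i}\partial_j=\Gamma_{ij}{}^k\partial_k$ with constant Christoffel symbols. Write $\mathcal M(\xi_1,\dots,\xi_8)$ for the model with $$(\Gamma_{11}{}^1,\Gamma_{11}{}^2,\Gamma_{12}{}^1,\Gamma_{12}{}^2,\Gamma_{21}{}^1,\Gamma_{21}{}^2,\Gamma_{22}{}^1,\Gamma_{22}{}^2)=(\xi_1,\dots,\xi_8).$$ Its torsion components are $T^i=\frac12(\Gamma_{12}{}^i-\Gamma_{21}{}^i)$. Two models are linearly equivalent if they differ by a linear change of basis, i.e. lie in the same orbit of $\mathrm{GL}(2,\mathbb R)$. Let $\mathfrak K(\mathcal M)$ be the real vector space of smooth vector fields $v=v^1\partial_1+v^2\partial_2$ on $\mathbb R^2$ that are affine Killing, i.e. for all $i,j,k$ (summing over $l$) $$\partial_i\partial_jv^k+v^l\partial_l\Gamma_{ij}{}^k-\Gamma_{ij}{}^l\partial_lv^k+\Gamma_{il}{}^k\partial_jv^l+\Gamma_{lj}{}^k\partial_iv^l=0 .$$ **Lemma.** Let $\mathcal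 M$ be a Type $\mathcal A$ model with $\dim\mathfrak K(\mathcal M)>2$. Then $\mathcal M$ is linearly equivalent to one of the models below for which $T=(T^1,T^2)\in\mathbb R^2$ satisfies the stated restriction. Under the restriction the listed vector fields form a basis of $\mathfrak K$; for every $T$ that violates the restriction, $\mathfrak K=\operatorname{span}\{\partial_1,\partial_2\}$. 1. $\mathcal M_0^6(T)=\mathcal M(0,0,T^1,T^2,-T^1,-T^2,0,0)$; no restriction on $T$. - $T=0$: $\partial_1,\ \partial_2,\ x^1\partial_1,\ x^1\partial_2,\ x^2\partial_1,\ x^2\partial_2$. - $T\ne0$: $\partial_1,\ \partial_2,\ x^1(T^1\partial_1+T^2\partial_2),\ x^2(T^1\partial_1+T^2\partial_2)$. 2. $\mathcal M_1^6(T)=\mathcal M(1,0,T^1,1+T^2,-T^1,1-T^2,0,0)$; restriction $T^1=0$. - $T=0$: $\partial_1,\ e^{-x^1}(\partial_1-x^2\partial_2),\ x^2\partial_2,\ x^2(\partial_1-x^2\partial_2),\ \partial_2,\ e^{-x^1}\partial_2$. - $T^1=0\ne T^2$: $\partial_1,\ \partial_2,\ x^2\partial_2,\ e^{-x^1}\partial_2$.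 3. $\mathcal M_2^6(T)=\mathcal M(-1,0,T^1,T^2,-T^1,-T^2,0,1)$; restriction $T^1T^2=0$. - $T=0$: $\partial_1,\ e^{x^1}\partial_1,\ e^{x^1+x^2}\partial_1,\ \partial_2,\ e^{-x^1-x^2}\partial_2,\ e^{-x^2}\partial_2$. - $T^1=0\ne T^2$: $\partial_1,\ \partial_2,\ e^{-x^1-x^2}\partial_2,\ e^{-x^2}\partial_2$. - $T^1\ne0=T^2$: $\partial_1,\ e^{x^1}\partial_1,\ e^{x^1+x^2}\partial_1,\ \partial_2$. 4. $\mathcal M_3^6(T)=\mathcal M(0,0,T^1,T^2,-T^1,-T^2,0,1)$; restriction $T^1T^2=0$. - $T=0$: $\partial_1,\ x^1\partial_1,\ e^{x^2}\partial_1,\ \partial_2,\ e^{-x^2}\partial_2,\ x^1e^{-x^2}\partial_2$. - $T^1=0\ne T^2$: $\partial_1,\ \partial_2,\ e^{-x^2}\partial_2,\ x^1e^{-x^2}\partial_2$. - $T^1\ne0=T^2$: $\partial_1,\ \partial_2,\ x^1\partial_1,\ e^{x^2}\partial_1$. 5. $\mathcal M_4^6(T)=\mathcal M(0,0,T^1,T^2,-T^1,-T^2,1,0)$;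 restriction $T^2=0$. - $T=0$: $\partial_1,\ \partial_2,\ (x^1+\frac12(x^2)^2)\partial_1,\ x^2\partial_1,\ (-x^1x^2-\frac12(x^2)^3)\partial_1+(x^1+\frac12(x^2)^2)\partial_2,\ -(x^2)^2\partial_1+x^2\partial_2$. - $T^1\ne0=T^2$: $\partial_1,\ \partial_2,\ (x^1+\frac12(x^2)^2)\partial_1,\ x^2\partial_1$. 6. $\mathcal M_5^6(T)=\mathcal M(1,0,T^1,1+T^2,-T^1,1-T^2,-1,0)$; restriction $T=0$: $\partial_1,\ \partial_2,\ \cos(2x^2)\partial_1-\sin(2x^2)\partial_2,\ \sin(2x^2)\partial_1+\cos(2x^2)\partial_2,\ e^{-x^1}(\cos(x^2)\partial_1-\sin(x^2)\partial_2),\ e^{-x^1}(\sin(x^2)\partial_1+\cos(x^2)\partial_2)$. 7. $\mathcal M_1^4(T)=\mathcal M(-1,0,1+T^1,T^2,1-T^1,-T^2,0,2)$; restriction $T^2=0$: $\partial_1,\ \partial_2,\ e^{x^1}\partial_1,\ x^2e^{x^1}\partial_1$. 8. $\mathcal M_2^4(c;T)=\mathcal M(-1,0,c+T^1,T^2,c-T^1,-T^2,0,1+2c)$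 with $c\in\mathbb R\setminus\{0,-1\}$; restriction $T^2=0$: $\partial_1,\ \partial_2,\ e^{x^1}\partial_1,\ e^{x^1+x^2}\partial_1$. 9. $\mathcal M_3^4(c;T)=\mathcal M(0,0,c+T^1,T^2,c-T^1,-T^2,0,1+2c)$ with $c\in\mathbb R\setminus\{0,-1\}$; restriction $T^2=0$: $\partial_1,\ \partial_2,\ e^{x^2}\partial_1,\ x^1\partial_1$. 10. $\mathcal M_4^4(c;T)=\mathcal M(0,0,1+T^1,T^2,1-T^1,-T^2,c,2)$ with $c\in\mathbb R$; restriction $T^2=0$: $\partial_1,\ \partial_2,\ (x^1+\frac c2(x^2)^2)\partial_1,\ x^2\partial_1$. 11. $\mathcal M_5^4(c;T)=\mathcal M(1,0,T^1,T^2,-T^1,-T^2,1+c^2,2c)$ with $c\in\mathbb R$; restriction $T^2=0$: $\partial_1,\ \partial_2,\ e^{-x^1+cx^2}\cos(x^2)\partial_1,\ e^{-x^1+cx^2}\sin(x^2)\partial_1$. -/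

import Mathlib

open scoped ContDiff

namespace AffineKilling

/-- The plane `ℝ²`; the coordinates `x¹, x²` are `x 0, x 1`, and all indices run over `Fin 2`. -/
abbrev Plane := Fin 2 → ℝ

/-- The partial derivative `∂f/∂xⁱ`. -/
noncomputable def pd (i : Fin 2) (f : Plane → ℝ) : Plane → ℝ :=
  fun x => fderiv ℝ f x (Pi.single i 1)

/-- A connection on the tangent bundle of `ℝ²`, possibly with torsion, given by its Christoffel
symbols: `Γ i j k` is the function `Γ_{ij}^k`, where `∇_i ∂_j = Γ_{ij}^k ∂_k`. -/
abbrev Christoffel := Fin 2 → Fin 2 → Fin 2 → Plane → ℝ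

/-- The affine Killing operator `K_{ij}^k`, that is, the components of the Lie derivative of the
connection `Γ` along the vector field `v`. -/
noncomputable def killingOp (Γ : Christoffel) (v : Plane → Plane) (i j k : Fin 2) (x : Plane) : ℝ :=
  pd i (pd j (fun y => v y k)) x +
    ∑ l, (v x l * pd l (Γ i j k) x - Γ i j l x * pd l (fun y => v y k) x
      + Γ i l k x * pd j (fun y => v y l) x + Γ l j k x * pd i (fun y => v y l) x)

/-- Affine Killing vector fields on `(ℝ², Γ)`. -/
def IsAffineKilling (Γ : Christoffel) (v : Plane → Plane) : Prop :=
  ContDiff ℝ ∞ v ∧ ∀ i j k x, killingOp Γ v i j k x = 0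

theorem contDiff_comp {v : Plane → Plane} (hv : ContDiff ℝ ∞ v) (k : Fin 2) :
    ContDiff ℝ ∞ (fun y => v y k) :=
  contDiff_pi.1 hv k

theorem contDiff_pd {f : Plane → ℝ} (hf : ContDiff ℝ ∞ f) (i : Fin 2) : ContDiff ℝ ∞ (pd i f) :=
  (hf.fderiv_right (m := ∞) (by simp)).clm_apply contDiff_const

theorem pd_add {f g : Plane → ℝ} (hf : ContDiff ℝ ∞ f) (hg : ContDiff ℝ ∞ g) (i : Fin 2) :
    pd i (fun y => f y + g y) = fun y => pd i f y + pd i g y := by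
  funext x
  have h1 := (hf.differentiable (by simp)) x
  have h2 := (hg.differentiable (by simp)) x
  simp only [pd]
  rw [fderiv_fun_add h1 h2]
  rfl

theorem pd_smul {f : Plane → ℝ} (hf : ContDiff ℝ ∞ f) (c : ℝ) (i : Fin 2) :
    pd i (fun y => c * f y) = fun y => c * pd i f y := by
  funext x
  have h1 := (hf.differentiable (by simp)) x
  simp only [pd]
  rw [fderiv_const_mul h1]
  rfl

/-- The real vector space `𝔎(ℝ², Γ)` of all affine Killing vector fields. -/
def killingAlgebra (Γ : Christoffel) : Submodule ℝ (Plane → Plane) where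
  carrier := {v | IsAffineKilling Γ v}
  zero_mem' := by
    have h0 : ∀ i, pd i (fun _ => (0 : ℝ)) = fun _ => 0 := by
      intro i; funext x; simp [pd]
    refine ⟨contDiff_const, fun i j k x => ?_⟩
    simp [killingOp, h0]
  add_mem' := by
    rintro v w ⟨hv, hv'⟩ ⟨hw, hw'⟩
    refine ⟨hv.add hw, fun i j k x => ?_⟩
    have e := congrArg₂ (· + ·) (hv' i j k x) (hw' i j k x)
    simp only [killingOp, Fin.sum_univ_two, Pi.add_apply,
      pd_add (contDiff_comp hv _) (contDiff_comp hw _),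
      pd_add (contDiff_pd (contDiff_comp hv _) _) (contDiff_pd (contDiff_comp hw _) _)] at e ⊢
    linarith
  smul_mem' := by
    rintro c v ⟨hv, hv'⟩
    refine ⟨contDiff_const.smul hv, fun i j k x => ?_⟩
    have e := congrArg (c * ·) (hv' i j k x)
    simp only [killingOp, Fin.sum_univ_two, Pi.smul_apply, smul_eq_mul,
      pd_smul (contDiff_comp hv _), pd_smul (contDiff_pd (contDiff_comp hv _) _)] at e ⊢
    linarith

/-- Type A models: connections on `ℝ²` whose Christoffel symbols are constant,
`A i j k = Γ_{ij}^k ∈ ℝ`. -/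
abbrev TypeA := Fin 2 → Fin 2 → Fin 2 → ℝ

/-- The connection of a Type A model. -/
def TypeA.connection (A : TypeA) : Christoffel := fun i j k _ => A i j k

/-- `𝔎(𝓜)` for a Type A model `𝓜`. -/
def TypeA.killing (A : TypeA) : Submodule ℝ (Plane → Plane) := killingAlgebra A.connection

/-- The Christoffel symbols of a Type A model in the basis `e'_i = ∑ a, P a i • e_a`. -/
noncomputable def TypeA.changeBasis (P : GL (Fin 2) ℝ) (A : TypeA) : TypeA := fun i j k =>
  ∑ a, ∑ b, ∑ c, P.val a i * P.val b j * (P⁻¹).val k c * A a b c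

/-- Two Type A models are linearly equivalent if they differ by a linear change of basis. -/
def TypeA.LinEquiv (A B : TypeA) : Prop := ∃ P : GL (Fin 2) ℝ, B = A.changeBasis P

/-- The model `𝓜(ξ₁, …, ξ₈)`, in the order
`Γ₁₁¹, Γ₁₁², Γ₁₂¹, Γ₁₂², Γ₂₁¹, Γ₂₁², Γ₂₂¹, Γ₂₂²`. -/
def model (ξ₁ ξ₂ ξ₃ ξ₄ ξ₅ ξ₆ ξ₇ ξ₈ : ℝ) : TypeA :=
  ![![![ξ₁, ξ₂], ![ξ₃, ξ₄]], ![![ξ₅, ξ₆], ![ξ₇, ξ₈]]]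

def M06 (T₁ T₂ : ℝ) : TypeA := model 0 0 T₁ T₂ (-T₁) (-T₂) 0 0
def M16 (T₁ T₂ : ℝ) : TypeA := model 1 0 T₁ (1 + T₂) (-T₁) (1 - T₂) 0 0
def M26 (T₁ T₂ : ℝ) : TypeA := model (-1) 0 T₁ T₂ (-T₁) (-T₂) 0 1
def M36 (T₁ T₂ : ℝ) : TypeA := model 0 0 T₁ T₂ (-T₁) (-T₂) 0 1
def M46 (T₁ T₂ : ℝ) : TypeA := model 0 0 T₁ T₂ (-T₁) (-T₂) 1 0
def M56 (T₁ T₂ : ℝ) : TypeA := model 1 0 T₁ (1 + T₂) (-T₁) (1 - T₂) (-1) 0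
def M14 (T₁ T₂ : ℝ) : TypeA := model (-1) 0 (1 + T₁) T₂ (1 - T₁) (-T₂) 0 2
def M24 (c T₁ T₂ : ℝ) : TypeA := model (-1) 0 (c + T₁) T₂ (c - T₁) (-T₂) 0 (1 + 2 * c)
def M34 (c T₁ T₂ : ℝ) : TypeA := model 0 0 (c + T₁) T₂ (c - T₁) (-T₂) 0 (1 + 2 * c)
def M44 (c T₁ T₂ : ℝ) : TypeA := model 0 0 (1 + T₁) T₂ (1 - T₁) (-T₂) c 2
def M54 (c T₁ T₂ : ℝ) : TypeA := model 1 0 T₁ T₂ (-T₁) (-T₂) (1 + c ^ 2) (2 * c)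

/-- The vector field `f ∂₁ + g ∂₂`, where `F x y = (f, g)` at the point `(x¹, x²) = (x, y)`. -/
def vf (F : ℝ → ℝ → ℝ × ℝ) : Plane → Plane :=
  fun p => ![(F (p 0) (p 1)).1, (F (p 0) (p 1)).2]

/-- The coordinate vector field `∂₁`. -/
def d₁ : Plane → Plane := vf fun _ _ => (1, 0)

/-- The coordinate vector field `∂₂`. -/
def d₂ : Plane → Plane := vf fun _ _ => (0, 1)

/-- The finite family `b` is a basis of `𝔎(𝓜)`: it is linearly independent and spans it. -/
def TypeA.HasKillingBasis (A : TypeA) {n : ℕ} (b : Fin n → Plane → Plane) : Prop :=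
  LinearIndependent ℝ b ∧ A.killing = Submodule.span ℝ (Set.range b)

/-- `𝔎(𝓜)` consists of the translations only: `𝔎(𝓜) = span {∂₁, ∂₂}`. -/
def TypeA.OnlyTranslations (A : TypeA) : Prop :=
  A.killing = Submodule.span ℝ {d₁, d₂}

end AffineKilling

/-!
The Christoffel symbols `A` of a Type A model are constant, so the Killing equation expresses the
second derivatives of a Killing field `v` linearly through its Jacobian `M`: one has
`∂ᵢ M = A.hess i M`. Two consequences drive everything.

* A Killing field is determined by its 1-jet at the origin, since along a ray `M` solves a linear
  ordinary differential equation (`eq_zero_of_jet`).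
* The derivatives `∂ᵢ v` of a Killing field are Killing fields (`pdv_mem`). Hence the space
  `A.isotropy` of all Jacobians at the origin is stable under the operators `A.hess i`, which
  commute on it (curvature), and `A.hess i M j = A.hess j M i` there (torsion).

*Bases.* The listed fields satisfy the equation. Their 1-jets at the origin fill up everything that
the linear torsion and curvature constraints on `M` leave room for; the coefficients in the proofs
solve the linear system for a given 1-jet `(q, M)`. When the restriction on `T` is violated, these
constraints, applied to `M` and `A.hess i M`, force `M = 0` (`hasKillingBasis_of_jets`,
`onlyTranslations_of_isotropy`).

*Classification.* Regard `a ∘ b = ∇_a b` as a product on `ℝ²`. If the Killing algebra has dimension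
greater than two, then `A.isotropy` is nonzero, and the commuting operators `A.hess i` have a joint
eigenvector `M` with eigenvalues `μ` on its complexification.

* If `μ ≠ 0`, the torsion constraint gives `M = μ ⊗ w`, so that `exp (μ₁ x¹ + μ₂ x²) w` is a complex
  Killing field. If `w` is real up to a factor, then `w` spans a two-sided ideal of `∘`
  (`isListed_of_real_direction`); otherwise `∘` is the multiplication of `ℂ`, which is the model
  `M56 0 0` (`isListed_of_complex_direction`).
* If `μ = 0`, then `∘` has a nonzero derivation, and again there is a two-sided ideal of dimension
  one or `∘` vanishes (`isListed_of_derivation`).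

A model with such an ideal has, in a basis whose first vector spans it, `Γ₁₁² = Γ₁₂² = Γ₂₁² = 0`.
The remaining freedom, to scale the two basis vectors and to add a multiple of the first to the
second, suffices to bring it to one of the ten other families (`isListed_of_line`). Which one it is
depends on whether `Γ₁₁¹` vanishes, on `Γ₂₂² - Γ₁₂¹ - Γ₂₁¹`, and on a discriminant.
-/

set_option linter.unusedSimpArgs false
set_option linter.unnecessarySeqFocus false

namespace AffineKilling

/-! ### The prolonged Killing equation -/

theorem pd_comm {f : Plane → ℝ} (hf : ContDiff ℝ ∞ f) (i j : Fin 2) :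
    pd i (pd j f) = pd j (pd i f) := by
  funext x
  have hd : DifferentiableAt ℝ (fderiv ℝ f) x :=
    ((hf.fderiv_right (m := ∞) (by simp)).differentiable (by simp)) x
  have key : ∀ a b : Fin 2, pd a (pd b f) x
      = fderiv ℝ (fderiv ℝ f) x (Pi.single a 1) (Pi.single b 1) := by
    intro a b
    change fderiv ℝ (fun y => fderiv ℝ f y (Pi.single b 1)) x (Pi.single a 1) = _
    rw [fderiv_clm_apply hd (differentiableAt_const _)]
    simp
  rw [key, key]
  exact (hf.contDiffAt.isSymmSndFDerivAt (by
    rw [minSmoothness_of_isRCLikeNormedField]; exact WithTop.coe_le_coe.2 le_top)) _ _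

theorem pd_sub {f g : Plane → ℝ} (hf : ContDiff ℝ ∞ f) (hg : ContDiff ℝ ∞ g) (i : Fin 2) :
    pd i (fun y => f y - g y) = fun y => pd i f y - pd i g y := by
  funext x
  simp only [pd]
  rw [fderiv_fun_sub ((hf.differentiable (by simp)) x) ((hg.differentiable (by simp)) x)]
  rfl

/-- The Jacobian of a vector field: `jac v x j k = ∂ⱼ vᵏ (x)`. -/
noncomputable def jac (v : Plane → Plane) (x : Plane) : Fin 2 → Fin 2 → ℝ :=
  fun j k => pd j (fun y => v y k) x

/-- For constant Christoffel symbols the Killing equation reads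
`∂ᵢ∂ⱼ vᵏ = Γᵢⱼˡ ∂ₗvᵏ - Γᵢₗᵏ ∂ⱼvˡ - Γₗⱼᵏ ∂ᵢvˡ`. This is its right-hand side, as a function of the
Jacobian `M` of `v`. -/
def TypeA.hess (A : TypeA) (i : Fin 2) : (Fin 2 → Fin 2 → ℝ) →ₗ[ℝ] (Fin 2 → Fin 2 → ℝ) where
  toFun M := fun j k => ∑ l, (A i j l * M l k - A i l k * M j l - A l j k * M i l)
  map_add' M N := by
    funext j k
    simp only [Fin.sum_univ_two, Pi.add_apply]
    ring
  map_smul' c M := by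
    funext j k
    simp only [Fin.sum_univ_two, Pi.smul_apply, smul_eq_mul, RingHom.id_apply]
    ring

theorem TypeA.hess_apply (A : TypeA) (i j k : Fin 2) (M : Fin 2 → Fin 2 → ℝ) :
    A.hess i M j k = ∑ l, (A i j l * M l k - A i l k * M j l - A l j k * M i l) := rfl

theorem mem_killing_iff {A : TypeA} {v : Plane → Plane} :
    v ∈ A.killing ↔ ContDiff ℝ ∞ v ∧
      ∀ i j k x, pd i (pd j (fun y => v y k)) x = A.hess i (jac v x) j k := by
  refine and_congr_right fun _ => forall_congr' fun i => forall_congr' fun j =>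
    forall_congr' fun k => forall_congr' fun x => ?_
  have h0 : ∀ l, pd l (A.connection i j k) x = 0 := fun l => by
    change fderiv ℝ (fun _ => A i j k) x _ = 0
    simp
  simp only [killingOp, h0, TypeA.hess_apply, Fin.sum_univ_two, TypeA.connection, jac]
  constructor <;> intro h <;> linarith

theorem contDiff_jac {v : Plane → Plane} (hv : ContDiff ℝ ∞ v) : ContDiff ℝ ∞ (jac v) :=
  contDiff_pi.2 fun j => contDiff_pi.2 fun k => contDiff_pd (contDiff_comp hv k) j

/-- The partial derivative of a vector field along a coordinate. -/
noncomputable def pdv (i : Fin 2) (v : Plane → Plane) : Plane → Plane :=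
  fun x k => pd i (fun y => v y k) x

theorem jac_pdv {A : TypeA} {v : Plane → Plane} (hv : v ∈ A.killing) (i : Fin 2) (x : Plane) :
    jac (pdv i v) x = A.hess i (jac v x) := by
  funext j k
  change pd j (pd i fun y => v y k) x = _
  rw [pd_comm (contDiff_comp hv.1 k), (mem_killing_iff.1 hv).2]

/-- As the Christoffel symbols are constant, the derivative of a Killing field along a coordinate
is again a Killing field. -/
theorem pdv_mem {A : TypeA} {v : Plane → Plane} (hv : v ∈ A.killing) (i : Fin 2) :
    pdv i v ∈ A.killing := by
  have hs : ∀ k, ContDiff ℝ ∞ (fun y => v y k) := contDiff_comp hv.1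
  have h2 := (mem_killing_iff.1 hv).2
  refine mem_killing_iff.2 ⟨contDiff_pi.2 fun k => contDiff_pd (hs k) i, fun a b k x => ?_⟩
  have e1 : pd a (pd b (pd i fun y => v y k)) = pd i (pd a (pd b fun y => v y k)) := by
    rw [pd_comm (hs k) b i, pd_comm (contDiff_pd (hs k) b) a i]
  have e2 : pd a (pd b fun y => v y k) = fun x => A.hess a (jac v x) b k :=
    funext fun x => h2 a b k x
  change pd a (pd b (pd i fun y => v y k)) x = _
  have hd : ∀ x, HasFDerivAt (jac v) (fderiv ℝ (jac v) x) x := fun x =>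
    ((contDiff_jac hv.1).differentiable (by simp) x).hasFDerivAt
  have e3 : ∀ x, jac (pdv i v) x = fderiv ℝ (jac v) x (Pi.single i 1) := by
    intro x
    funext j k
    have h := hasFDerivAt_pi'.1 (hasFDerivAt_pi'.1 (hd x) j) k
    change pd j (pd i fun y => v y k) x = _
    rw [pd_comm (hs k)]
    change fderiv ℝ (fun y => jac v y j k) x _ = _
    rw [h.fderiv]
    rfl
  rw [e1, e2]
  let L : (Fin 2 → Fin 2 → ℝ) →L[ℝ] ℝ :=
    (ContinuousLinearMap.proj k).comp
      ((ContinuousLinearMap.proj (R := ℝ) (φ := fun _ => Fin 2 → ℝ) b).comp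
        (LinearMap.toContinuousLinearMap (A.hess a)))
  have hL : HasFDerivAt (fun x => L (jac v x)) (L.comp (fderiv ℝ (jac v) x)) x :=
    L.hasFDerivAt.comp x (hd x)
  change fderiv ℝ (fun x => L (jac v x)) x _ = _
  rw [hL.fderiv, e3]
  rfl

/-- The torsion constraint on the Jacobian of a Killing field. -/
theorem hess_symm {A : TypeA} {v : Plane → Plane} (hv : v ∈ A.killing) (x : Plane)
    (i j k : Fin 2) : A.hess i (jac v x) j k = A.hess j (jac v x) i k := by
  rw [← (mem_killing_iff.1 hv).2, ← (mem_killing_iff.1 hv).2, pd_comm (contDiff_comp hv.1 k)]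

/-- The curvature constraint on the Jacobian of a Killing field. -/
theorem hess_comm {A : TypeA} {v : Plane → Plane} (hv : v ∈ A.killing) (x : Plane)
    (i j : Fin 2) : A.hess i (A.hess j (jac v x)) = A.hess j (A.hess i (jac v x)) := by
  have h : pdv i (pdv j v) = pdv j (pdv i v) := by
    funext x k
    exact congrFun (pd_comm (contDiff_comp hv.1 k) i j) x
  rw [← jac_pdv hv, ← jac_pdv hv, ← jac_pdv (pdv_mem hv _), ← jac_pdv (pdv_mem hv _), h]

/-- A Killing field is determined by its value and its Jacobian at the origin: along each ray the
Jacobian solves a linear ordinary differential equation. -/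
theorem eq_zero_of_jet {A : TypeA} {v : Plane → Plane} (hv : v ∈ A.killing) (h0 : v 0 = 0)
    (h1 : jac v 0 = 0) : v = 0 := by
  have hs := contDiff_jac hv.1
  have hd : ∀ x, HasFDerivAt (jac v) (fderiv ℝ (jac v) x) x := fun x =>
    (hs.differentiable (by simp) x).hasFDerivAt
  have e3 : ∀ x i, fderiv ℝ (jac v) x (Pi.single i 1) = A.hess i (jac v x) := by
    intro x i
    funext j k
    have h := hasFDerivAt_pi'.1 (hasFDerivAt_pi'.1 (hd x) j) k
    rw [← (mem_killing_iff.1 hv).2]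
    change _ = fderiv ℝ (fun y => jac v y j k) x _
    rw [h.fderiv]
    rfl
  have hx : ∀ x : Plane, x = x 0 • Pi.single 0 1 + x 1 • Pi.single 1 1 := by
    intro x; funext i; fin_cases i <;> simp
  have hjac : ∀ x, jac v x = 0 := by
    intro x
    let L : (Fin 2 → Fin 2 → ℝ) →L[ℝ] (Fin 2 → Fin 2 → ℝ) :=
      LinearMap.toContinuousLinearMap (x 0 • A.hess 0 + x 1 • A.hess 1)
    have hg : ∀ t : ℝ, HasDerivAt (fun t : ℝ => jac v (t • x)) (L (jac v (t • x))) t := by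
      intro t
      have h1 : HasDerivAt (fun t : ℝ => t • x) x t := by
        simpa using (hasDerivAt_id t).smul_const x
      have h2 := (hd (t • x)).comp_hasDerivAt t h1
      have h3 : fderiv ℝ (jac v) (t • x) x = L (jac v (t • x)) := by
        calc fderiv ℝ (jac v) (t • x) x
            = fderiv ℝ (jac v) (t • x) (x 0 • Pi.single 0 1 + x 1 • Pi.single 1 1) := by
              rw [← hx x]
          _ = L (jac v (t • x)) := by
              rw [map_add, map_smul, map_smul, e3, e3]
              rfl
      rw [← h3]
      exact h2
    have h := ODE_solution_unique_univ (v := fun _ => L) (s := fun _ => Set.univ) (K := ‖L‖₊)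
      (f := fun t : ℝ => jac v (t • x)) (g := fun _ => 0) (t₀ := 0)
      (fun t => L.lipschitz.lipschitzOnWith) (fun t => ⟨hg t, trivial⟩)
      (fun t => ⟨by simpa using hasDerivAt_const t (0 : Fin 2 → Fin 2 → ℝ), trivial⟩)
      (by simp [h1])
    simpa using congrFun h 1
  have hdv : Differentiable ℝ v := hv.1.differentiable (by simp)
  have hf : ∀ x, fderiv ℝ v x = 0 := by
    intro x
    have h : ∀ i, fderiv ℝ v x (Pi.single i 1) = 0 := by
      intro i
      funext k
      have h := hasFDerivAt_pi'.1 (hdv x).hasFDerivAt k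
      have h' : fderiv ℝ (fun y => v y k) x (Pi.single i 1) = 0 := congrFun (congrFun (hjac x) i) k
      rw [h.fderiv] at h'
      exact h'
    ext1 y
    rw [hx y, map_add, map_smul, map_smul, h, h]
    simp
  funext x
  rw [is_const_of_fderiv_eq_zero hdv hf x 0, h0]
  rfl

/-! ### Partial derivatives of explicit functions -/

attribute [simp] pd_add pd_sub

@[simp]
theorem pd_const (c : ℝ) (i : Fin 2) : pd i (fun _ => c) = fun _ => 0 := by
  funext x
  simp [pd]

@[simp]
theorem pd_coord (i j : Fin 2) : pd i (fun y => y j) = fun _ => if j = i then 1 else 0 := by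
  funext x
  have h := hasFDerivAt_pi'.1 (hasFDerivAt_id (𝕜 := ℝ) x) j
  change fderiv ℝ (fun y : Plane => id y j) x _ = _
  rw [h.fderiv]
  simp [Pi.single_apply]

@[simp]
theorem pd_neg {f : Plane → ℝ} (i : Fin 2) :
    pd i (fun y => -f y) = fun y => -pd i f y := by
  funext x
  simp only [pd]
  rw [fderiv_fun_neg]
  rfl

@[simp]
theorem pd_mul {f g : Plane → ℝ} (hf : ContDiff ℝ ∞ f) (hg : ContDiff ℝ ∞ g) (i : Fin 2) :
    pd i (fun y => f y * g y) = fun y => f y * pd i g y + g y * pd i f y := by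
  funext x
  simp only [pd]
  rw [fderiv_fun_mul ((hf.differentiable (by simp)) x) ((hg.differentiable (by simp)) x)]
  rfl

@[simp]
theorem pd_pow {f : Plane → ℝ} (hf : ContDiff ℝ ∞ f) (n : ℕ) (i : Fin 2) :
    pd i (fun y => f y ^ n) = fun y => n * f y ^ (n - 1) * pd i f y := by
  funext x
  simp only [pd]
  rw [fderiv_fun_pow n ((hf.differentiable (by simp)) x)]
  simp

@[simp]
theorem pd_exp {f : Plane → ℝ} (hf : ContDiff ℝ ∞ f) (i : Fin 2) :
    pd i (fun y => Real.exp (f y)) = fun y => Real.exp (f y) * pd i f y := by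
  funext x
  simp only [pd]
  rw [fderiv_exp ((hf.differentiable (by simp)) x)]
  rfl

@[simp]
theorem pd_cos {f : Plane → ℝ} (hf : ContDiff ℝ ∞ f) (i : Fin 2) :
    pd i (fun y => Real.cos (f y)) = fun y => -(Real.sin (f y) * pd i f y) := by
  funext x
  simp only [pd]
  rw [fderiv_cos ((hf.differentiable (by simp)) x)]
  simp

@[simp]
theorem pd_sin {f : Plane → ℝ} (hf : ContDiff ℝ ∞ f) (i : Fin 2) :
    pd i (fun y => Real.sin (f y)) = fun y => Real.cos (f y) * pd i f y := by
  funext x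
  simp only [pd]
  rw [fderiv_sin ((hf.differentiable (by simp)) x)]
  rfl

theorem vf_mem {A : TypeA} {F : ℝ → ℝ → ℝ × ℝ}
    (hf : ContDiff ℝ ∞ fun p : Plane => (F (p 0) (p 1)).1)
    (hg : ContDiff ℝ ∞ fun p : Plane => (F (p 0) (p 1)).2)
    (h : ∀ i j x,
      pd i (pd j fun p => (F (p 0) (p 1)).1) x = A.hess i (jac (vf F) x) j 0 ∧
      pd i (pd j fun p => (F (p 0) (p 1)).2) x = A.hess i (jac (vf F) x) j 1) :
    vf F ∈ A.killing := by
  refine mem_killing_iff.2 ⟨contDiff_pi.2 (Fin.forall_fin_two.2 ⟨hf, hg⟩), fun i j => ?_⟩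
  exact Fin.forall_fin_two.2 ⟨fun x => (h i j x).1, fun x => (h i j x).2⟩

theorem jac_vf (F : ℝ → ℝ → ℝ × ℝ) (x : Plane) : jac (vf F) x =
    ![![pd 0 (fun p => (F (p 0) (p 1)).1) x, pd 0 (fun p => (F (p 0) (p 1)).2) x],
      ![pd 1 (fun p => (F (p 0) (p 1)).1) x, pd 1 (fun p => (F (p 0) (p 1)).2) x]] := by
  funext j k
  fin_cases j <;> fin_cases k <;> rfl

/-! ### The isotropy representation -/

/-- The Jacobian at the origin, as a linear map on the Killing algebra. -/
noncomputable def TypeA.jacobianAtZero (A : TypeA) : A.killing →ₗ[ℝ] (Fin 2 → Fin 2 → ℝ) where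
  toFun v := jac v 0
  map_add' v w := by
    funext j k
    exact congrFun (pd_add (contDiff_comp v.2.1 k) (contDiff_comp w.2.1 k) j) 0
  map_smul' c v := by
    funext j k
    exact congrFun (pd_smul (contDiff_comp v.2.1 k) c j) 0

/-- The isotropy representation of the Killing algebra: all Jacobians at the origin of Killing
fields. Since translations are Killing fields, it does not matter whether the field vanishes at
the origin. -/
noncomputable def TypeA.isotropy (A : TypeA) : Submodule ℝ (Fin 2 → Fin 2 → ℝ) :=
  LinearMap.range A.jacobianAtZero

theorem jac_mem_isotropy {A : TypeA} {v : Plane → Plane} (hv : v ∈ A.killing) :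
    jac v 0 ∈ A.isotropy := ⟨⟨v, hv⟩, rfl⟩

theorem hess_mem_isotropy {A : TypeA} {M : Fin 2 → Fin 2 → ℝ} (hM : M ∈ A.isotropy)
    (i : Fin 2) : A.hess i M ∈ A.isotropy := by
  obtain ⟨⟨v, hv⟩, rfl⟩ := hM
  exact (jac_pdv hv i 0) ▸ jac_mem_isotropy (pdv_mem hv i)

theorem isotropy_symm {A : TypeA} {M : Fin 2 → Fin 2 → ℝ} (hM : M ∈ A.isotropy)
    (i j k : Fin 2) : A.hess i M j k = A.hess j M i k := by
  obtain ⟨⟨v, hv⟩, rfl⟩ := hM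
  exact hess_symm hv 0 i j k

theorem isotropy_comm {A : TypeA} {M : Fin 2 → Fin 2 → ℝ} (hM : M ∈ A.isotropy)
    (i j : Fin 2) : A.hess i (A.hess j M) = A.hess j (A.hess i M) := by
  obtain ⟨⟨v, hv⟩, rfl⟩ := hM
  exact hess_comm hv 0 i j

theorem vf_const_mem (A : TypeA) (a b : ℝ) : vf (fun _ _ => (a, b)) ∈ A.killing := by
  refine vf_mem contDiff_const contDiff_const fun i j x => ?_
  have h : jac (vf fun _ _ => (a, b)) x = 0 := by
    rw [jac_vf]
    funext j k
    fin_cases j <;> fin_cases k <;> simp [pd_const]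
  rw [h, map_zero]
  simp [pd_const]

theorem d₁_mem (A : TypeA) : d₁ ∈ A.killing := vf_const_mem A 1 0

theorem d₂_mem (A : TypeA) : d₂ ∈ A.killing := vf_const_mem A 0 1

theorem eq_of_jet {A : TypeA} {v w : Plane → Plane} (hv : v ∈ A.killing) (hw : w ∈ A.killing)
    (h0 : v 0 = w 0) (h1 : jac v 0 = jac w 0) : v = w := by
  have h : A.jacobianAtZero (⟨v, hv⟩ - ⟨w, hw⟩) = 0 := by
    rw [map_sub]
    exact sub_eq_zero.2 h1
  exact sub_eq_zero.1 (eq_zero_of_jet (A.killing.sub_mem hv hw) (sub_eq_zero.2 h0) h)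

theorem jac_sum {A : TypeA} {n : ℕ} {b : Fin n → Plane → Plane} (hb : ∀ i, b i ∈ A.killing)
    (c : Fin n → ℝ) : jac (∑ i, c i • b i) 0 = ∑ i, c i • jac (b i) 0 := by
  have h := map_sum A.jacobianAtZero (fun i => c i • (⟨b i, hb i⟩ : A.killing)) Finset.univ
  simp only [map_smul] at h
  refine Eq.trans ?_ h
  change _ = jac _ 0
  congr 1
  simp

/-- Killing fields form a basis as soon as their 1-jets at the origin are linearly independent and
span all the 1-jets that a Killing field can have. -/
theorem hasKillingBasis_of_jets {A : TypeA} {n : ℕ} {b : Fin n → Plane → Plane}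
    (hmem : ∀ i, b i ∈ A.killing)
    (hli : ∀ c : Fin n → ℝ, ∑ i, c i • b i 0 = 0 → ∑ i, c i • jac (b i) 0 = 0 → c = 0)
    (hspan : ∀ M ∈ A.isotropy, ∀ q : Plane,
      ∃ c : Fin n → ℝ, ∑ i, c i • b i 0 = q ∧ ∑ i, c i • jac (b i) 0 = M) :
    A.HasKillingBasis b := by
  constructor
  · refine Fintype.linearIndependent_iff.2 fun c hc => congrFun (hli c ?_ ?_)
    · simpa using congrFun hc 0
    · rw [← jac_sum hmem, hc]
      exact map_zero A.jacobianAtZero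
  · refine le_antisymm (fun v hv => ?_) (Submodule.span_le.2 (Set.range_subset_iff.2 hmem))
    obtain ⟨c, h0, h1⟩ := hspan _ (jac_mem_isotropy hv) (v 0)
    have hs : ∑ i, c i • b i ∈ Submodule.span ℝ (Set.range b) :=
      Submodule.sum_mem _ fun i _ => Submodule.smul_mem _ _ (Submodule.subset_span ⟨i, rfl⟩)
    have hk : ∑ i, c i • b i ∈ A.killing :=
      Submodule.sum_mem _ fun i _ => Submodule.smul_mem _ _ (hmem i)
    rw [eq_of_jet hv hk (by simp [← h0]) (by rw [jac_sum hmem, h1])]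
    exact hs

theorem onlyTranslations_of_isotropy {A : TypeA} (h : ∀ M ∈ A.isotropy, M = 0) :
    A.OnlyTranslations := by
  refine le_antisymm (fun v hv => ?_) (Submodule.span_le.2 ?_)
  · have hw := vf_const_mem A (v 0 0) (v 0 1)
    have e : v = vf (fun _ _ => (v 0 0, v 0 1)) := by
      refine eq_of_jet hv hw ?_ ?_
      · funext k
        fin_cases k <;> rfl
      · rw [h _ (jac_mem_isotropy hv), h _ (jac_mem_isotropy hw)]
    refine Submodule.mem_span_pair.2 ⟨v 0 0, v 0 1, ?_⟩
    conv_rhs => rw [e]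
    funext x k
    fin_cases k <;> simp [d₁, d₂, vf]
  · rintro _ (rfl | rfl)
    exacts [d₁_mem A, d₂_mem A]

/-! ### The Killing algebras of the listed models -/

theorem M06_basis_zero : (M06 0 0).HasKillingBasis
    ![d₁, d₂, vf fun x _ => (x, 0), vf fun x _ => (0, x), vf fun _ y => (y, 0),
      vf fun _ y => (0, y)] := by
  refine hasKillingBasis_of_jets ?_ (fun c => ?_) fun M hM q =>
    ⟨![q 0, q 1, M 0 0, M 0 1, M 1 0, M 1 1], ?_⟩
  · simp only [Fin.forall_fin_succ, Matrix.cons_val_zero, Matrix.cons_val_succ]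
    refine ⟨d₁_mem _, d₂_mem _, ?_, ?_, ?_, ?_, fun i => i.elim0⟩
    all_goals
      refine vf_mem (by fun_prop) (by fun_prop) ?_
      simp (disch := fun_prop) [Fin.forall_fin_two, TypeA.hess_apply, jac_vf, M06, model]
  · simp (disch := fun_prop) [Fin.sum_univ_succ, jac_vf, d₁, d₂, vf, funext_iff,
      Fin.forall_fin_succ] <;>
    grind
  · simp (disch := fun_prop) [Fin.sum_univ_succ, jac_vf, d₁, d₂, vf, funext_iff,
      Fin.forall_fin_succ]

theorem sum_sq_ne_zero {a b : ℝ} (h : (a, b) ≠ (0, 0)) : a ^ 2 + b ^ 2 ≠ 0 := by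
  intro h0
  refine h (Prod.ext ?_ ?_) <;> simp only <;> nlinarith [sq_nonneg a, sq_nonneg b]

theorem M06_basis {T₁ T₂ : ℝ} (hT : (T₁, T₂) ≠ (0, 0)) : (M06 T₁ T₂).HasKillingBasis
    ![d₁, d₂, vf fun x _ => (x * T₁, x * T₂), vf fun _ y => (y * T₁, y * T₂)] := by
  have hS : T₁ ^ 2 + T₂ ^ 2 ≠ 0 := sum_sq_ne_zero hT
  refine hasKillingBasis_of_jets ?_ (fun c => ?_) fun M hM q =>
    ⟨![q 0, q 1, (T₁ * M 0 0 + T₂ * M 0 1) / (T₁ ^ 2 + T₂ ^ 2),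
      (T₁ * M 1 0 + T₂ * M 1 1) / (T₁ ^ 2 + T₂ ^ 2)], ?_⟩
  · simp only [Fin.forall_fin_succ, Matrix.cons_val_zero, Matrix.cons_val_succ]
    refine ⟨d₁_mem _, d₂_mem _, ?_, ?_, fun i => i.elim0⟩
    all_goals
      refine vf_mem (by fun_prop) (by fun_prop) ?_
      simp (disch := fun_prop) [Fin.forall_fin_two, TypeA.hess_apply, jac_vf, M06, model] <;>
      grind
  · simp (disch := fun_prop) [Fin.sum_univ_succ, jac_vf, d₁, d₂, vf, funext_iff,
      Fin.forall_fin_succ] <;>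
    grind
  · have h := isotropy_symm hM 0 1
    simp [Fin.forall_fin_two, TypeA.hess_apply, M06, model] at h
    simp (disch := fun_prop) [Fin.sum_univ_succ, jac_vf, d₁, d₂, vf, funext_iff,
      Fin.forall_fin_succ]
    refine ⟨⟨?_, ?_⟩, ?_, ?_⟩ <;> rw [div_mul_eq_mul_div, div_eq_iff hS] <;> grind

theorem M16_basis_zero : (M16 0 0).HasKillingBasis
    ![d₁, vf fun x y => (Real.exp (-x), -(Real.exp (-x) * y)), vf fun _ y => (0, y),
      vf fun _ y => (y, -y ^ 2), d₂, vf fun x _ => (0, Real.exp (-x))] := by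
  refine hasKillingBasis_of_jets ?_ (fun c => ?_) fun M hM q =>
    ⟨![q 0 + M 0 0, -M 0 0, M 1 1 - M 0 0, M 1 0, q 1 + M 0 1, -M 0 1], ?_⟩
  · simp only [Fin.forall_fin_succ, Matrix.cons_val_zero, Matrix.cons_val_succ]
    refine ⟨d₁_mem _, ?_, ?_, ?_, d₂_mem _, ?_, fun i => i.elim0⟩
    all_goals
      refine vf_mem (by fun_prop) (by fun_prop) ?_
      simp (disch := fun_prop) [Fin.forall_fin_two, TypeA.hess_apply, jac_vf, M16, model] <;>
      grind
  · simp (disch := fun_prop) [Fin.sum_univ_succ, jac_vf, d₁, d₂, vf, funext_iff,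
      Fin.forall_fin_succ] <;>
    grind
  · simp (disch := fun_prop) [Fin.sum_univ_succ, jac_vf, d₁, d₂, vf, funext_iff,
      Fin.forall_fin_succ]

theorem M16_basis {T₂ : ℝ} (hT : T₂ ≠ 0) : (M16 0 T₂).HasKillingBasis
    ![d₁, d₂, vf fun _ y => (0, y), vf fun x _ => (0, Real.exp (-x))] := by
  refine hasKillingBasis_of_jets ?_ (fun c => ?_) fun M hM q =>
    ⟨![q 0, q 1 + M 0 1, M 1 1, -M 0 1], ?_⟩
  · simp only [Fin.forall_fin_succ, Matrix.cons_val_zero, Matrix.cons_val_succ]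
    refine ⟨d₁_mem _, d₂_mem _, ?_, ?_, fun i => i.elim0⟩
    all_goals
      refine vf_mem (by fun_prop) (by fun_prop) ?_
      simp (disch := fun_prop) [Fin.forall_fin_two, TypeA.hess_apply, jac_vf, M16, model] <;>
      grind
  · simp (disch := fun_prop) [Fin.sum_univ_succ, jac_vf, d₁, d₂, vf, funext_iff,
      Fin.forall_fin_succ] <;>
    grind
  · have h := isotropy_symm hM 0 1
    simp [Fin.forall_fin_two, TypeA.hess_apply, M16, model] at h
    simp (disch := fun_prop) [Fin.sum_univ_succ, jac_vf, d₁, d₂, vf, funext_iff,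
      Fin.forall_fin_succ] <;>
    grind

theorem M16_onlyTranslations {T₁ : ℝ} (T₂ : ℝ) (hT : T₁ ≠ 0) : (M16 T₁ T₂).OnlyTranslations := by
  refine onlyTranslations_of_isotropy fun M hM => ?_
  have h := isotropy_symm hM 0 1
  have h0 := isotropy_symm (hess_mem_isotropy hM 0) 0 1
  have h1 := isotropy_symm (hess_mem_isotropy hM 1) 0 1
  simp [Fin.forall_fin_two, TypeA.hess_apply, M16, model, funext_iff] at h h0 h1 ⊢
  grind

theorem M26_basis_zero : (M26 0 0).HasKillingBasis
    ![d₁, vf fun x _ => (Real.exp x, 0), vf fun x y => (Real.exp (x + y), 0), d₂,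
      vf fun x y => (0, Real.exp (-x - y)), vf fun _ y => (0, Real.exp (-y))] := by
  refine hasKillingBasis_of_jets ?_ (fun c => ?_) fun M hM q =>
    ⟨![q 0 - M 0 0, M 0 0 - M 1 0, M 1 0, q 1 + M 1 1, -M 0 1, M 0 1 - M 1 1], ?_⟩
  · simp only [Fin.forall_fin_succ, Matrix.cons_val_zero, Matrix.cons_val_succ]
    refine ⟨d₁_mem _, ?_, ?_, d₂_mem _, ?_, ?_, fun i => i.elim0⟩
    all_goals
      refine vf_mem (by fun_prop) (by fun_prop) ?_
      simp (disch := fun_prop) [Fin.forall_fin_two, TypeA.hess_apply, jac_vf, M26, model]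
  · simp (disch := fun_prop) [Fin.sum_univ_succ, jac_vf, d₁, d₂, vf, funext_iff,
      Fin.forall_fin_succ] <;>
    grind
  · simp (disch := fun_prop) [Fin.sum_univ_succ, jac_vf, d₁, d₂, vf, funext_iff,
      Fin.forall_fin_succ] <;>
    grind

theorem M26_basis_left {T₂ : ℝ} (hT : T₂ ≠ 0) : (M26 0 T₂).HasKillingBasis
    ![d₁, d₂, vf fun x y => (0, Real.exp (-x - y)), vf fun _ y => (0, Real.exp (-y))] := by
  refine hasKillingBasis_of_jets ?_ (fun c => ?_) fun M hM q =>
    ⟨![q 0, q 1 + M 1 1, -M 0 1, M 0 1 - M 1 1], ?_⟩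
  · simp only [Fin.forall_fin_succ, Matrix.cons_val_zero, Matrix.cons_val_succ]
    refine ⟨d₁_mem _, d₂_mem _, ?_, ?_, fun i => i.elim0⟩
    all_goals
      refine vf_mem (by fun_prop) (by fun_prop) ?_
      simp (disch := fun_prop) [Fin.forall_fin_two, TypeA.hess_apply, jac_vf, M26, model]
  · simp (disch := fun_prop) [Fin.sum_univ_succ, jac_vf, d₁, d₂, vf, funext_iff,
      Fin.forall_fin_succ] <;>
    grind
  · have h := isotropy_symm hM 0 1
    simp [Fin.forall_fin_two, TypeA.hess_apply, M26, model] at h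
    simp (disch := fun_prop) [Fin.sum_univ_succ, jac_vf, d₁, d₂, vf, funext_iff,
      Fin.forall_fin_succ] <;>
    grind

theorem M26_basis_right {T₁ : ℝ} (hT : T₁ ≠ 0) : (M26 T₁ 0).HasKillingBasis
    ![d₁, vf fun x _ => (Real.exp x, 0), vf fun x y => (Real.exp (x + y), 0), d₂] := by
  refine hasKillingBasis_of_jets ?_ (fun c => ?_) fun M hM q =>
    ⟨![q 0 - M 0 0, M 0 0 - M 1 0, M 1 0, q 1], ?_⟩
  · simp only [Fin.forall_fin_succ, Matrix.cons_val_zero, Matrix.cons_val_succ]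
    refine ⟨d₁_mem _, ?_, ?_, d₂_mem _, fun i => i.elim0⟩
    all_goals
      refine vf_mem (by fun_prop) (by fun_prop) ?_
      simp (disch := fun_prop) [Fin.forall_fin_two, TypeA.hess_apply, jac_vf, M26, model]
  · simp (disch := fun_prop) [Fin.sum_univ_succ, jac_vf, d₁, d₂, vf, funext_iff,
      Fin.forall_fin_succ] <;>
    grind
  · have h := isotropy_symm hM 0 1
    simp [Fin.forall_fin_two, TypeA.hess_apply, M26, model] at h
    simp (disch := fun_prop) [Fin.sum_univ_succ, jac_vf, d₁, d₂, vf, funext_iff,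
      Fin.forall_fin_succ] <;>
    grind

theorem M26_onlyTranslations {T₁ T₂ : ℝ} (hT : T₁ * T₂ ≠ 0) : (M26 T₁ T₂).OnlyTranslations := by
  refine onlyTranslations_of_isotropy fun M hM => ?_
  have h := isotropy_symm hM 0 1
  have h0 := isotropy_symm (hess_mem_isotropy hM 0) 0 1
  have h1 := isotropy_symm (hess_mem_isotropy hM 1) 0 1
  simp [Fin.forall_fin_two, TypeA.hess_apply, M26, model, funext_iff] at h h0 h1 ⊢
  grind

theorem M36_basis_zero : (M36 0 0).HasKillingBasis
    ![d₁, vf fun x _ => (x, 0), vf fun _ y => (Real.exp y, 0), d₂,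
      vf fun _ y => (0, Real.exp (-y)), vf fun x y => (0, x * Real.exp (-y))] := by
  refine hasKillingBasis_of_jets ?_ (fun c => ?_) fun M hM q =>
    ⟨![q 0 - M 1 0, M 0 0, M 1 0, q 1 + M 1 1, -M 1 1, M 0 1], ?_⟩
  · simp only [Fin.forall_fin_succ, Matrix.cons_val_zero, Matrix.cons_val_succ]
    refine ⟨d₁_mem _, ?_, ?_, d₂_mem _, ?_, ?_, fun i => i.elim0⟩
    all_goals
      refine vf_mem (by fun_prop) (by fun_prop) ?_
      simp (disch := fun_prop) [Fin.forall_fin_two, TypeA.hess_apply, jac_vf, M36, model]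
  · simp (disch := fun_prop) [Fin.sum_univ_succ, jac_vf, d₁, d₂, vf, funext_iff,
      Fin.forall_fin_succ] <;>
    grind
  · simp (disch := fun_prop) [Fin.sum_univ_succ, jac_vf, d₁, d₂, vf, funext_iff,
      Fin.forall_fin_succ]

theorem M36_basis_left {T₂ : ℝ} (hT : T₂ ≠ 0) : (M36 0 T₂).HasKillingBasis
    ![d₁, d₂, vf fun _ y => (0, Real.exp (-y)), vf fun x y => (0, x * Real.exp (-y))] := by
  refine hasKillingBasis_of_jets ?_ (fun c => ?_) fun M hM q =>
    ⟨![q 0, q 1 + M 1 1, -M 1 1, M 0 1], ?_⟩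
  · simp only [Fin.forall_fin_succ, Matrix.cons_val_zero, Matrix.cons_val_succ]
    refine ⟨d₁_mem _, d₂_mem _, ?_, ?_, fun i => i.elim0⟩
    all_goals
      refine vf_mem (by fun_prop) (by fun_prop) ?_
      simp (disch := fun_prop) [Fin.forall_fin_two, TypeA.hess_apply, jac_vf, M36, model] <;>
      grind
  · simp (disch := fun_prop) [Fin.sum_univ_succ, jac_vf, d₁, d₂, vf, funext_iff,
      Fin.forall_fin_succ] <;>
    grind
  · have h := isotropy_symm hM 0 1
    simp [Fin.forall_fin_two, TypeA.hess_apply, M36, model] at h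
    simp (disch := fun_prop) [Fin.sum_univ_succ, jac_vf, d₁, d₂, vf, funext_iff,
      Fin.forall_fin_succ] <;>
    grind

theorem M36_basis_right {T₁ : ℝ} (hT : T₁ ≠ 0) : (M36 T₁ 0).HasKillingBasis
    ![d₁, d₂, vf fun x _ => (x, 0), vf fun _ y => (Real.exp y, 0)] := by
  refine hasKillingBasis_of_jets ?_ (fun c => ?_) fun M hM q =>
    ⟨![q 0 - M 1 0, q 1, M 0 0, M 1 0], ?_⟩
  · simp only [Fin.forall_fin_succ, Matrix.cons_val_zero, Matrix.cons_val_succ]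
    refine ⟨d₁_mem _, d₂_mem _, ?_, ?_, fun i => i.elim0⟩
    all_goals
      refine vf_mem (by fun_prop) (by fun_prop) ?_
      simp (disch := fun_prop) [Fin.forall_fin_two, TypeA.hess_apply, jac_vf, M36, model]
  · simp (disch := fun_prop) [Fin.sum_univ_succ, jac_vf, d₁, d₂, vf, funext_iff,
      Fin.forall_fin_succ] <;>
    grind
  · have h := isotropy_symm hM 0 1
    simp [Fin.forall_fin_two, TypeA.hess_apply, M36, model] at h
    simp (disch := fun_prop) [Fin.sum_univ_succ, jac_vf, d₁, d₂, vf, funext_iff,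
      Fin.forall_fin_succ] <;>
    grind

theorem M36_onlyTranslations {T₁ T₂ : ℝ} (hT : T₁ * T₂ ≠ 0) : (M36 T₁ T₂).OnlyTranslations := by
  refine onlyTranslations_of_isotropy fun M hM => ?_
  have h := isotropy_symm hM 0 1
  have h0 := isotropy_symm (hess_mem_isotropy hM 0) 0 1
  have h1 := isotropy_symm (hess_mem_isotropy hM 1) 0 1
  simp [Fin.forall_fin_two, TypeA.hess_apply, M36, model, funext_iff] at h h0 h1 ⊢
  grind

theorem M46_basis_zero : (M46 0 0).HasKillingBasis
    ![d₁, d₂, vf fun x y => (x + 1 / 2 * y ^ 2, 0), vf fun _ y => (y, 0),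
      vf fun x y => (-(x * y) - 1 / 2 * y ^ 3, x + 1 / 2 * y ^ 2),
      vf fun _ y => (-y ^ 2, y)] := by
  refine hasKillingBasis_of_jets ?_ (fun c => ?_) fun M hM q =>
    ⟨![q 0, q 1, M 0 0, M 1 0, M 0 1, M 1 1], ?_⟩
  · simp only [Fin.forall_fin_succ, Matrix.cons_val_zero, Matrix.cons_val_succ]
    refine ⟨d₁_mem _, d₂_mem _, ?_, ?_, ?_, ?_, fun i => i.elim0⟩
    all_goals
      refine vf_mem (by fun_prop) (by fun_prop) ?_
      simp (disch := fun_prop) [Fin.forall_fin_two, TypeA.hess_apply, jac_vf, M46, model] <;>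
      grind
  · simp (disch := fun_prop) [Fin.sum_univ_succ, jac_vf, d₁, d₂, vf, funext_iff,
      Fin.forall_fin_succ] <;>
    grind
  · simp (disch := fun_prop) [Fin.sum_univ_succ, jac_vf, d₁, d₂, vf, funext_iff,
      Fin.forall_fin_succ] <;>
    grind

theorem M46_basis {T₁ : ℝ} (hT : T₁ ≠ 0) : (M46 T₁ 0).HasKillingBasis
    ![d₁, d₂, vf fun x y => (x + 1 / 2 * y ^ 2, 0), vf fun _ y => (y, 0)] := by
  refine hasKillingBasis_of_jets ?_ (fun c => ?_) fun M hM q => ⟨![q 0, q 1, M 0 0, M 1 0], ?_⟩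
  · simp only [Fin.forall_fin_succ, Matrix.cons_val_zero, Matrix.cons_val_succ]
    refine ⟨d₁_mem _, d₂_mem _, ?_, ?_, fun i => i.elim0⟩
    all_goals
      refine vf_mem (by fun_prop) (by fun_prop) ?_
      simp (disch := fun_prop) [Fin.forall_fin_two, TypeA.hess_apply, jac_vf, M46, model]
  · simp (disch := fun_prop) [Fin.sum_univ_succ, jac_vf, d₁, d₂, vf, funext_iff,
      Fin.forall_fin_succ] <;>
    grind
  · have h := isotropy_symm hM 0 1
    simp [Fin.forall_fin_two, TypeA.hess_apply, M46, model] at h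
    simp (disch := fun_prop) [Fin.sum_univ_succ, jac_vf, d₁, d₂, vf, funext_iff,
      Fin.forall_fin_succ] <;>
    grind

theorem M46_onlyTranslations (T₁ : ℝ) {T₂ : ℝ} (hT : T₂ ≠ 0) : (M46 T₁ T₂).OnlyTranslations := by
  refine onlyTranslations_of_isotropy fun M hM => ?_
  have h := isotropy_symm hM 0 1
  have h0 := isotropy_symm (hess_mem_isotropy hM 0) 0 1
  have h1 := isotropy_symm (hess_mem_isotropy hM 1) 0 1
  simp [Fin.forall_fin_two, TypeA.hess_apply, M46, model, funext_iff] at h h0 h1 ⊢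
  grind

theorem M56_basis_zero : (M56 0 0).HasKillingBasis
    ![d₁, d₂, vf fun _ y => (Real.cos (2 * y), -Real.sin (2 * y)),
      vf fun _ y => (Real.sin (2 * y), Real.cos (2 * y)),
      vf fun x y => (Real.exp (-x) * Real.cos y, -(Real.exp (-x) * Real.sin y)),
      vf fun x y => (Real.exp (-x) * Real.sin y, Real.exp (-x) * Real.cos y)] := by
  refine hasKillingBasis_of_jets ?_ (fun c => ?_) fun M hM q =>
    ⟨![q 0 + (M 0 0 + M 1 1) / 2, q 1 + (M 0 1 - M 1 0) / 2, (M 0 0 - M 1 1) / 2,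
      (M 0 1 + M 1 0) / 2, -M 0 0, -M 0 1], ?_⟩
  · simp only [Fin.forall_fin_succ, Matrix.cons_val_zero, Matrix.cons_val_succ]
    refine ⟨d₁_mem _, d₂_mem _, ?_, ?_, ?_, ?_, fun i => i.elim0⟩
    all_goals
      refine vf_mem (by fun_prop) (by fun_prop) ?_
      simp (disch := fun_prop) [Fin.forall_fin_two, TypeA.hess_apply, jac_vf, M56, model] <;>
      grind
  · simp (disch := fun_prop) [Fin.sum_univ_succ, jac_vf, d₁, d₂, vf, funext_iff,
      Fin.forall_fin_succ] <;>
    grind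
  · simp (disch := fun_prop) [Fin.sum_univ_succ, jac_vf, d₁, d₂, vf, funext_iff,
      Fin.forall_fin_succ] <;>
    grind

theorem M56_onlyTranslations {T₁ T₂ : ℝ} (hT : (T₁, T₂) ≠ (0, 0)) :
    (M56 T₁ T₂).OnlyTranslations := by
  refine onlyTranslations_of_isotropy fun M hM => ?_
  have h := isotropy_symm hM 0 1
  have h0 := isotropy_symm (hess_mem_isotropy hM 0) 0 1
  have h1 := isotropy_symm (hess_mem_isotropy hM 1) 0 1
  simp [Fin.forall_fin_two, TypeA.hess_apply, M56, model, funext_iff] at h h0 h1 ⊢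
  have hS := sum_sq_ne_zero hT
  have ha : M 0 0 = 0 := by
    refine (mul_eq_zero.1 (?_ : (T₁ ^ 2 + T₂ ^ 2) * M 0 0 = 0)).resolve_left hS
    grind
  have hb : M 0 1 = 0 := by
    refine (mul_eq_zero.1 (?_ : (T₁ ^ 2 + T₂ ^ 2) * M 0 1 = 0)).resolve_left hS
    grind
  have hc' : M 1 0 = 0 := by
    refine (mul_eq_zero.1 (?_ : (T₁ ^ 2 + T₂ ^ 2) * M 1 0 = 0)).resolve_left hS
    grind
  have hd : M 1 1 = 0 := by
    refine (mul_eq_zero.1 (?_ : (T₁ ^ 2 + T₂ ^ 2) * M 1 1 = 0)).resolve_left hS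
    grind
  exact ⟨⟨ha, hb⟩, hc', hd⟩

theorem M14_basis (T₁ : ℝ) : (M14 T₁ 0).HasKillingBasis
    ![d₁, d₂, vf fun x _ => (Real.exp x, 0), vf fun x y => (y * Real.exp x, 0)] := by
  refine hasKillingBasis_of_jets ?_ (fun c => ?_) fun M hM q =>
    ⟨![q 0 - M 0 0, q 1, M 0 0, M 1 0], ?_⟩
  · simp only [Fin.forall_fin_succ, Matrix.cons_val_zero, Matrix.cons_val_succ]
    refine ⟨d₁_mem _, d₂_mem _, ?_, ?_, fun i => i.elim0⟩
    all_goals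
      refine vf_mem (by fun_prop) (by fun_prop) ?_
      simp (disch := fun_prop) [Fin.forall_fin_two, TypeA.hess_apply, jac_vf, M14, model] <;>
      grind
  · simp (disch := fun_prop) [Fin.sum_univ_succ, jac_vf, d₁, d₂, vf, funext_iff,
      Fin.forall_fin_succ] <;>
    grind
  · have h := isotropy_symm hM 0 1
    have hc := isotropy_comm hM 0 1
    simp [Fin.forall_fin_two, TypeA.hess_apply, M14, model, funext_iff] at h hc
    simp (disch := fun_prop) [Fin.sum_univ_succ, jac_vf, d₁, d₂, vf, funext_iff,
      Fin.forall_fin_succ] <;>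
    grind

theorem M14_onlyTranslations (T₁ : ℝ) {T₂ : ℝ} (hT : T₂ ≠ 0) : (M14 T₁ T₂).OnlyTranslations := by
  refine onlyTranslations_of_isotropy fun M hM => ?_
  have h := isotropy_symm hM 0 1
  have h0 := isotropy_symm (hess_mem_isotropy hM 0) 0 1
  have h1 := isotropy_symm (hess_mem_isotropy hM 1) 0 1
  have hc := isotropy_comm hM 0 1
  simp [Fin.forall_fin_two, TypeA.hess_apply, M14, model, funext_iff] at h h0 h1 hc ⊢
  grind

theorem M24_basis {c : ℝ} (hc₀ : c ≠ 0) (hc₁ : c ≠ -1) (T₁ : ℝ) : (M24 c T₁ 0).HasKillingBasis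
    ![d₁, d₂, vf fun x _ => (Real.exp x, 0), vf fun x y => (Real.exp (x + y), 0)] := by
  refine hasKillingBasis_of_jets ?_ (fun c => ?_) fun M hM q =>
    ⟨![q 0 - M 0 0, q 1, M 0 0 - M 1 0, M 1 0], ?_⟩
  · simp only [Fin.forall_fin_succ, Matrix.cons_val_zero, Matrix.cons_val_succ]
    refine ⟨d₁_mem _, d₂_mem _, ?_, ?_, fun i => i.elim0⟩
    all_goals
      refine vf_mem (by fun_prop) (by fun_prop) ?_
      simp (disch := fun_prop) [Fin.forall_fin_two, TypeA.hess_apply, jac_vf, M24, model] <;>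
      grind
  · simp (disch := fun_prop) [Fin.sum_univ_succ, jac_vf, d₁, d₂, vf, funext_iff,
      Fin.forall_fin_succ] <;>
    grind
  · have h := isotropy_symm hM 0 1
    have hc := isotropy_comm hM 0 1
    simp [Fin.forall_fin_two, TypeA.hess_apply, M24, model, funext_iff] at h hc
    simp (disch := fun_prop) [Fin.sum_univ_succ, jac_vf, d₁, d₂, vf, funext_iff,
      Fin.forall_fin_succ] <;>
    grind

theorem M24_onlyTranslations {c : ℝ} (hc₀ : c ≠ 0) (hc₁ : c ≠ -1) (T₁ : ℝ) {T₂ : ℝ} (hT : T₂ ≠ 0) :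
    (M24 c T₁ T₂).OnlyTranslations := by
  refine onlyTranslations_of_isotropy fun M hM => ?_
  have h := isotropy_symm hM 0 1
  have h0 := isotropy_symm (hess_mem_isotropy hM 0) 0 1
  have h1 := isotropy_symm (hess_mem_isotropy hM 1) 0 1
  have hc := isotropy_comm hM 0 1
  simp [Fin.forall_fin_two, TypeA.hess_apply, M24, model, funext_iff] at h h0 h1 hc ⊢
  grind

theorem M34_basis {c : ℝ} (hc₀ : c ≠ 0) (hc₁ : c ≠ -1) (T₁ : ℝ) : (M34 c T₁ 0).HasKillingBasis
    ![d₁, d₂, vf fun _ y => (Real.exp y, 0), vf fun x _ => (x, 0)] := by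
  refine hasKillingBasis_of_jets ?_ (fun c => ?_) fun M hM q =>
    ⟨![q 0 - M 1 0, q 1, M 1 0, M 0 0], ?_⟩
  · simp only [Fin.forall_fin_succ, Matrix.cons_val_zero, Matrix.cons_val_succ]
    refine ⟨d₁_mem _, d₂_mem _, ?_, ?_, fun i => i.elim0⟩
    all_goals
      refine vf_mem (by fun_prop) (by fun_prop) ?_
      simp (disch := fun_prop) [Fin.forall_fin_two, TypeA.hess_apply, jac_vf, M34, model] <;>
      grind
  · simp (disch := fun_prop) [Fin.sum_univ_succ, jac_vf, d₁, d₂, vf, funext_iff,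
      Fin.forall_fin_succ] <;>
    grind
  · have h := isotropy_symm hM 0 1
    have hc := isotropy_comm hM 0 1
    simp [Fin.forall_fin_two, TypeA.hess_apply, M34, model, funext_iff] at h hc
    simp (disch := fun_prop) [Fin.sum_univ_succ, jac_vf, d₁, d₂, vf, funext_iff,
      Fin.forall_fin_succ] <;>
    grind

theorem M34_onlyTranslations {c : ℝ} (hc₀ : c ≠ 0) (T₁ : ℝ) {T₂ : ℝ} (hT : T₂ ≠ 0) :
    (M34 c T₁ T₂).OnlyTranslations := by
  refine onlyTranslations_of_isotropy fun M hM => ?_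
  have h := isotropy_symm hM 0 1
  have hc := isotropy_comm hM 0 1
  simp [Fin.forall_fin_two, TypeA.hess_apply, M34, model, funext_iff] at h hc ⊢
  grind

theorem M44_basis (c T₁ : ℝ) : (M44 c T₁ 0).HasKillingBasis
    ![d₁, d₂, vf fun x y => (x + c / 2 * y ^ 2, 0), vf fun _ y => (y, 0)] := by
  refine hasKillingBasis_of_jets ?_ (fun c => ?_) fun M hM q => ⟨![q 0, q 1, M 0 0, M 1 0], ?_⟩
  · simp only [Fin.forall_fin_succ, Matrix.cons_val_zero, Matrix.cons_val_succ]
    refine ⟨d₁_mem _, d₂_mem _, ?_, ?_, fun i => i.elim0⟩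
    all_goals
      refine vf_mem (by fun_prop) (by fun_prop) ?_
      simp (disch := fun_prop) [Fin.forall_fin_two, TypeA.hess_apply, jac_vf, M44, model] <;>
      grind
  · simp (disch := fun_prop) [Fin.sum_univ_succ, jac_vf, d₁, d₂, vf, funext_iff,
      Fin.forall_fin_succ] <;>
    grind
  · have h := isotropy_symm hM 0 1
    have hc := isotropy_comm hM 0 1
    simp [Fin.forall_fin_two, TypeA.hess_apply, M44, model, funext_iff] at h hc
    simp (disch := fun_prop) [Fin.sum_univ_succ, jac_vf, d₁, d₂, vf, funext_iff,
      Fin.forall_fin_succ] <;>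
    grind

theorem M44_onlyTranslations (c T₁ : ℝ) {T₂ : ℝ} (hT : T₂ ≠ 0) :
    (M44 c T₁ T₂).OnlyTranslations := by
  refine onlyTranslations_of_isotropy fun M hM => ?_
  have h := isotropy_symm hM 0 1
  have hc := isotropy_comm hM 0 1
  simp [Fin.forall_fin_two, TypeA.hess_apply, M44, model, funext_iff] at h hc ⊢
  grind

theorem M54_basis (c T₁ : ℝ) : (M54 c T₁ 0).HasKillingBasis
    ![d₁, d₂, vf fun x y => (Real.exp (-x + c * y) * Real.cos y, 0),
      vf fun x y => (Real.exp (-x + c * y) * Real.sin y, 0)] := by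
  refine hasKillingBasis_of_jets ?_ (fun c => ?_) fun M hM q =>
    ⟨![q 0 + M 0 0, q 1, -M 0 0, M 1 0 + c * M 0 0], ?_⟩
  · simp only [Fin.forall_fin_succ, Matrix.cons_val_zero, Matrix.cons_val_succ]
    refine ⟨d₁_mem _, d₂_mem _, ?_, ?_, fun i => i.elim0⟩
    all_goals
      refine vf_mem (by fun_prop) (by fun_prop) ?_
      simp (disch := fun_prop) [Fin.forall_fin_two, TypeA.hess_apply, jac_vf, M54, model] <;>
      grind
  · simp (disch := fun_prop) [Fin.sum_univ_succ, jac_vf, d₁, d₂, vf, funext_iff,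
      Fin.forall_fin_succ] <;>
    grind
  · have h := isotropy_symm hM 0 1
    have hc := isotropy_comm hM 0 1
    simp [Fin.forall_fin_two, TypeA.hess_apply, M54, model, funext_iff] at h hc
    simp (disch := fun_prop) [Fin.sum_univ_succ, jac_vf, d₁, d₂, vf, funext_iff,
      Fin.forall_fin_succ]
    have hS : 1 + c ^ 2 ≠ 0 := by positivity
    have hb : M 0 1 = 0 := by
      refine (mul_eq_zero.1 (?_ : (1 + c ^ 2) * M 0 1 = 0)).resolve_left hS
      grind
    have hd : M 1 1 = 0 := by
      refine (mul_eq_zero.1 (?_ : (1 + c ^ 2) * M 1 1 = 0)).resolve_left hS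
      grind
    grind

theorem M54_onlyTranslations (c T₁ : ℝ) {T₂ : ℝ} (hT : T₂ ≠ 0) :
    (M54 c T₁ T₂).OnlyTranslations := by
  refine onlyTranslations_of_isotropy fun M hM => ?_
  have h := isotropy_symm hM 0 1
  have h0 := isotropy_symm (hess_mem_isotropy hM 0) 0 1
  have h1 := isotropy_symm (hess_mem_isotropy hM 1) 0 1
  have hc := isotropy_comm hM 0 1
  simp [Fin.forall_fin_two, TypeA.hess_apply, M54, model, funext_iff] at h h0 h1 hc ⊢
  have hS : 1 + c ^ 2 ≠ 0 := by positivity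
  have hb : M 0 1 = 0 := by
    refine (mul_eq_zero.1 (?_ : (1 + c ^ 2) * M 0 1 = 0)).resolve_left hS
    grind
  have hd : M 1 1 = 0 := by
    refine (mul_eq_zero.1 (?_ : (1 + c ^ 2) * M 1 1 = 0)).resolve_left hS
    grind
  grind

/-! ### Linear equivalence -/

theorem TypeA.LinEquiv.trans {A B C : TypeA} (h : A.LinEquiv B) (h' : B.LinEquiv C) :
    A.LinEquiv C := by
  obtain ⟨P, rfl⟩ := h
  obtain ⟨Q, rfl⟩ := h'
  refine ⟨P * Q, ?_⟩
  funext i j k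
  simp only [TypeA.changeBasis, mul_inv_rev, Units.val_mul, Matrix.mul_apply, Fin.sum_univ_two]
  ring

theorem linEquiv_of_basis {A B : TypeA} (P : Matrix (Fin 2) (Fin 2) ℝ) (hP : P.det ≠ 0)
    (h : ∀ i j k, ∑ a, ∑ b, P a i * P b j * A a b k = ∑ c, P k c * B i j c) :
    A.LinEquiv B := by
  let Q : GL (Fin 2) ℝ := Matrix.GeneralLinearGroup.mkOfDetNeZero P hP
  refine ⟨Q, ?_⟩
  have hinv : (Q⁻¹).val * P = 1 := by
    have := Q.inv_mul
    exact this
  have e : ∀ k c, ∑ l, (Q⁻¹).val k l * P l c = if k = c then 1 else 0 := by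
    intro k c
    rw [← Matrix.mul_apply, hinv, Matrix.one_apply]
  funext i j k
  have h1 : ∀ l, (Q⁻¹).val k l * ∑ a, ∑ b, P a i * P b j * A a b l
      = (Q⁻¹).val k l * ∑ c, P l c * B i j c := fun l => by rw [h]
  have e0 := e k 0
  have e1 := e k 1
  have s0 := h1 0
  have s1 := h1 1
  change _ = ∑ a, ∑ b, ∑ c, P a i * P b j * (Q⁻¹).val k c * A a b c
  simp only [Fin.sum_univ_two] at e0 e1 s0 s1 ⊢
  have t : B i j k = (if k = 0 then 1 else 0) * B i j 0 + (if k = 1 then 1 else 0) * B i j 1 := by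
    fin_cases k <;> simp
  rw [t, ← e0, ← e1]
  linear_combination -s0 - s1

theorem exists_linEquiv_of_basis (A : TypeA) (P : Matrix (Fin 2) (Fin 2) ℝ) (hP : P.det ≠ 0) :
    ∃ B : TypeA, A.LinEquiv B ∧
      ∀ i j k, ∑ a, ∑ b, P a i * P b j * A a b k = ∑ c, P k c * B i j c := by
  let Q : GL (Fin 2) ℝ := Matrix.GeneralLinearGroup.mkOfDetNeZero P hP
  refine ⟨A.changeBasis Q, ⟨Q, rfl⟩, fun i j k => ?_⟩
  have hinv : P * (Q⁻¹).val = 1 := Q.mul_inv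
  have e : ∀ l, ∑ c, P k c * (Q⁻¹).val c l = if k = l then 1 else 0 := by
    intro l
    rw [← Matrix.mul_apply, hinv, Matrix.one_apply]
  have e0 := e 0
  have e1 := e 1
  change _ = ∑ d, P k d * ∑ a, ∑ b, ∑ c, P a i * P b j * (Q⁻¹).val d c * A a b c
  have t : ∀ a b, A a b k
      = (if k = 0 then 1 else 0) * A a b 0 + (if k = 1 then 1 else 0) * A a b 1 := by
    intro a b
    fin_cases k <;> simp
  simp only [Fin.sum_univ_two] at e0 e1 ⊢
  simp only [t, ← e0, ← e1]
  ring

/-! ### Normal forms of the models with an invariant line -/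

/-- The model is linearly equivalent to a member of one of the eleven families whose torsion
satisfies the restriction of that family. -/
def TypeA.IsListed (A : TypeA) : Prop :=
  (∃ T₁ T₂ : ℝ, A.LinEquiv (M06 T₁ T₂)) ∨
  (∃ T₁ T₂ : ℝ, T₁ = 0 ∧ A.LinEquiv (M16 T₁ T₂)) ∨
  (∃ T₁ T₂ : ℝ, T₁ * T₂ = 0 ∧ A.LinEquiv (M26 T₁ T₂)) ∨
  (∃ T₁ T₂ : ℝ, T₁ * T₂ = 0 ∧ A.LinEquiv (M36 T₁ T₂)) ∨
  (∃ T₁ T₂ : ℝ, T₂ = 0 ∧ A.LinEquiv (M46 T₁ T₂)) ∨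
  (∃ T₁ T₂ : ℝ, T₁ = 0 ∧ T₂ = 0 ∧ A.LinEquiv (M56 T₁ T₂)) ∨
  (∃ T₁ T₂ : ℝ, T₂ = 0 ∧ A.LinEquiv (M14 T₁ T₂)) ∨
  (∃ c T₁ T₂ : ℝ, c ≠ 0 ∧ c ≠ -1 ∧ T₂ = 0 ∧ A.LinEquiv (M24 c T₁ T₂)) ∨
  (∃ c T₁ T₂ : ℝ, c ≠ 0 ∧ c ≠ -1 ∧ T₂ = 0 ∧ A.LinEquiv (M34 c T₁ T₂)) ∨
  (∃ c T₁ T₂ : ℝ, T₂ = 0 ∧ A.LinEquiv (M44 c T₁ T₂)) ∨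
  (∃ c T₁ T₂ : ℝ, T₂ = 0 ∧ A.LinEquiv (M54 c T₁ T₂))

theorem isListed_M06 {A : TypeA} {T₁ T₂ : ℝ} (h : A.LinEquiv (M06 T₁ T₂)) : A.IsListed :=
  .inl ⟨_, _, h⟩

theorem isListed_M16 {A : TypeA} {T₂ : ℝ} (h : A.LinEquiv (M16 0 T₂)) : A.IsListed :=
  .inr <| .inl ⟨_, _, rfl, h⟩

theorem isListed_M26 {A : TypeA} {T₁ T₂ : ℝ} (hT : T₁ * T₂ = 0) (h : A.LinEquiv (M26 T₁ T₂)) :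
    A.IsListed :=
  .inr <| .inr <| .inl ⟨_, _, hT, h⟩

theorem isListed_M36 {A : TypeA} {T₁ T₂ : ℝ} (hT : T₁ * T₂ = 0) (h : A.LinEquiv (M36 T₁ T₂)) :
    A.IsListed :=
  .inr <| .inr <| .inr <| .inl ⟨_, _, hT, h⟩

theorem isListed_M46 {A : TypeA} {T₁ : ℝ} (h : A.LinEquiv (M46 T₁ 0)) : A.IsListed :=
  .inr <| .inr <| .inr <| .inr <| .inl ⟨_, _, rfl, h⟩

theorem isListed_M56 {A : TypeA} (h : A.LinEquiv (M56 0 0)) : A.IsListed :=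
  .inr <| .inr <| .inr <| .inr <| .inr <| .inl ⟨_, _, rfl, rfl, h⟩

theorem isListed_M14 {A : TypeA} {T₁ : ℝ} (h : A.LinEquiv (M14 T₁ 0)) : A.IsListed :=
  .inr <| .inr <| .inr <| .inr <| .inr <| .inr <| .inl ⟨_, _, rfl, h⟩

theorem isListed_M44 {A : TypeA} {c T₁ : ℝ} (h : A.LinEquiv (M44 c T₁ 0)) : A.IsListed :=
  .inr <| .inr <| .inr <| .inr <| .inr <| .inr <| .inr <| .inr <| .inr <| .inl ⟨_, _, _, rfl, h⟩

theorem isListed_M54 {A : TypeA} {c T₁ : ℝ} (h : A.LinEquiv (M54 c T₁ 0)) : A.IsListed :=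
  .inr <| .inr <| .inr <| .inr <| .inr <| .inr <| .inr <| .inr <| .inr <| .inr ⟨_, _, _, rfl, h⟩

/-- For the exceptional values `c = 0` and `c = -1` the model `M24 c` is flat up to torsion, and
is equivalent to a member of the family `M26`. -/
theorem isListed_M24 {A : TypeA} {c T₁ : ℝ} (h : A.LinEquiv (M24 c T₁ 0)) : A.IsListed := by
  rcases eq_or_ne c 0 with rfl | hc₀
  · refine isListed_M26 (T₁ := T₁) (T₂ := 0) (by simp) ?_
    convert h using 1
    simp [M26, M24]
  rcases eq_or_ne c (-1) with rfl | hc₁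
  · refine isListed_M26 (T₁ := 0) (T₂ := -T₁) (by simp) (h.trans ?_)
    refine linEquiv_of_basis !![-1, -1; 1, 0] (by simp) ?_
    simp [Fin.forall_fin_two, Fin.sum_univ_two, M26, M24, model]
    norm_num
  · exact .inr <| .inr <| .inr <| .inr <| .inr <| .inr <| .inr <| .inl ⟨_, _, _, hc₀, hc₁, rfl, h⟩

/-- For the exceptional values `c = 0` and `c = -1` the model `M34 c` is flat up to torsion, and
is equivalent to a member of the families `M36` and `M16`, respectively. -/
theorem isListed_M34 {A : TypeA} {c T₁ : ℝ} (h : A.LinEquiv (M34 c T₁ 0)) : A.IsListed := by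
  rcases eq_or_ne c 0 with rfl | hc₀
  · refine isListed_M36 (T₁ := T₁) (T₂ := 0) (by simp) ?_
    convert h using 1
    simp [M36, M34]
  rcases eq_or_ne c (-1) with rfl | hc₁
  · refine isListed_M16 (T₂ := T₁) (h.trans ?_)
    refine linEquiv_of_basis !![0, 1; -1, 0] (by simp) ?_
    simp [Fin.forall_fin_two, Fin.sum_univ_two, M16, M34, model]
    grind
  · exact .inr <| .inr <| .inr <| .inr <| .inr <| .inr <| .inr <| .inr <|
      .inl ⟨_, _, _, hc₀, hc₁, rfl, h⟩

/-- The models with `∇_{∂₁}∂₁ = 0` in which the first basis vector spans a two-sided ideal. -/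
theorem isListed_of_nilpotent_line {A : TypeA} {p q g r : ℝ}
    (h : A.LinEquiv (model 0 0 p 0 q 0 g r)) : A.IsListed := by
  rcases eq_or_ne (r - p - q) 0 with hs | hs
  · obtain rfl : r = p + q := by linarith
    rcases eq_or_ne (p + q) 0 with hc | hc
    · obtain rfl : q = -p := by linarith
      rcases eq_or_ne g 0 with rfl | hg
      · refine isListed_M06 (T₁ := p) (T₂ := 0) ?_
        convert h using 1
        simp [M06]
      · refine isListed_M46 (T₁ := p) (h.trans ?_)
        refine linEquiv_of_basis !![g, 0; 0, 1] (by simpa using hg) ?_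
        simp [Fin.forall_fin_two, Fin.sum_univ_two, M46, model]
    · refine isListed_M44 (c := g * (2 / (p + q)) ^ 2) (T₁ := (p - q) / (p + q)) (h.trans ?_)
      refine linEquiv_of_basis !![1, 0; 0, 2 / (p + q)] (by simpa using hc) ?_
      simp [Fin.forall_fin_two, Fin.sum_univ_two, M44, model]
      grind
  · refine isListed_M34 (c := (p + q) / (2 * (r - p - q))) (T₁ := (p - q) / (2 * (r - p - q)))
      (h.trans ?_)
    refine linEquiv_of_basis !![1, g / (r - p - q) ^ 2; 0, 1 / (r - p - q)] (by simpa using hs) ?_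
    simp [Fin.forall_fin_two, Fin.sum_univ_two, M34, model]
    refine ⟨?_, ?_, ?_, ?_⟩ <;> field_simp <;> ring

/-- The models with `∇_{∂₁}∂₁ = -∂₁` in which the first basis vector spans a two-sided ideal and
`∇_{∂₂}∂₂` is a multiple of `∂₂`. -/
theorem isListed_of_two_lines {A : TypeA} {p q r : ℝ}
    (h : A.LinEquiv (model (-1) 0 p 0 q 0 0 r)) : A.IsListed := by
  rcases eq_or_ne (r - p - q) 0 with hs | hs
  · obtain rfl : r = p + q := by linarith
    rcases eq_or_ne (p + q) 0 with hc | hc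
    · obtain rfl : q = -p := by linarith
      refine isListed_M36 (T₁ := 0) (T₂ := -p) (by simp) (h.trans ?_)
      refine linEquiv_of_basis !![0, -1; 1, 0] (by simp) ?_
      simp [Fin.forall_fin_two, Fin.sum_univ_two, M36, model]
    · refine isListed_M14 (T₁ := (p - q) / (p + q)) (h.trans ?_)
      refine linEquiv_of_basis !![1, 0; 0, 2 / (p + q)] (by simpa using hc) ?_
      simp [Fin.forall_fin_two, Fin.sum_univ_two, M14, model]
      refine ⟨?_, ?_, ?_⟩ <;> field_simp <;> ring
  · refine isListed_M24 (c := (p + q) / (2 * (r - p - q))) (T₁ := (p - q) / (2 * (r - p - q)))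
      (h.trans ?_)
    refine linEquiv_of_basis !![1, 0; 0, 1 / (r - p - q)] (by simpa using hs) ?_
    simp [Fin.forall_fin_two, Fin.sum_univ_two, M24, model]
    refine ⟨?_, ?_, ?_⟩ <;> field_simp <;> ring

/-- The models in which the first basis vector spans a two-sided ideal of the product `∇_a b`. If
`∇_{∂₁}∂₁ ≠ 0`, the other lines `ℝ w` with `∇_w w ∈ ℝ w` are the roots of a quadratic polynomial; the
models without such lines form the family `M54`. -/
theorem isListed_of_line {A : TypeA} {k p q g r : ℝ}
    (h : A.LinEquiv (model k 0 p 0 q 0 g r)) : A.IsListed := by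
  rcases eq_or_ne k 0 with rfl | hk
  · exact isListed_of_nilpotent_line h
  rcases lt_or_ge ((r - p - q) ^ 2 - 4 * g * k) 0 with hD | hD
  · set σ : ℝ := 2 / √(-((r - p - q) ^ 2 - 4 * g * k)) with hσ
    have hσ0 : σ ≠ 0 := by
      have : 0 < √(-((r - p - q) ^ 2 - 4 * g * k)) := Real.sqrt_pos.2 (by linarith)
      positivity
    have hσ2 : σ ^ 2 * (4 * g * k - (r - p - q) ^ 2) = 4 := by
      rw [hσ, div_pow, Real.sq_sqrt (by linarith), div_mul_eq_mul_div, div_eq_iff (by linarith)]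
      ring
    refine isListed_M54 (c := σ * r / 2) (T₁ := σ * (p - q) / 2) (h.trans ?_)
    refine linEquiv_of_basis !![1 / k, -(σ * (p + q)) / (2 * k); 0, σ] ?_ ?_
    · simp [hk, hσ0]
    simp [Fin.forall_fin_two, Fin.sum_univ_two, M54, model]
    grind
  · obtain ⟨u, hu⟩ := exists_quadratic_eq_zero (a := k) (b := -(r - p - q)) (c := g) hk
      ⟨√((r - p - q) ^ 2 - 4 * g * k), by
        rw [Real.mul_self_sqrt hD, discrim]
        ring⟩
    refine isListed_of_two_lines (p := p + u * k) (q := q + u * k) (r := r) (h.trans ?_)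
    refine linEquiv_of_basis !![-1 / k, u; 0, 1] ?_ ?_
    · simp [hk]
    simp [Fin.forall_fin_two, Fin.sum_univ_two, model]
    grind

/-! ### The prolonged Killing equation over the complex numbers -/

/-- `M` is a joint eigenvector of the complexified operators `A.hess i`, with eigenvalues `μ i`.
For complex Killing fields these are the Jacobians of the form `exp (μ₁ x¹ + μ₂ x²) M`. -/
def TypeA.IsEigen (A : TypeA) (μ : Fin 2 → ℂ) (M : Fin 2 → Fin 2 → ℂ) : Prop :=
  ∀ i j k, μ i * M j k =
    ∑ l, ((A i j l : ℂ) * M l k - (A i l k : ℂ) * M j l - (A l j k : ℂ) * M i l)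

/-- Joint eigenvectors in a new basis. -/
theorem TypeA.IsEigen.of_basis {A B : TypeA} {P : Matrix (Fin 2) (Fin 2) ℝ} (hP : P.det ≠ 0)
    (h : ∀ i j k, ∑ a, ∑ b, P a i * P b j * A a b k = ∑ c, P k c * B i j c)
    {μ : Fin 2 → ℂ} {M N : Fin 2 → Fin 2 → ℂ} (hM : A.IsEigen μ M)
    (hN : ∀ j k, ∑ c, (P k c : ℂ) * N j c = ∑ b, (P b j : ℂ) * M b k) :
    B.IsEigen (fun i => ∑ a, μ a * P a i) N := by
  intro i j
  have h' : ∀ i j k, ∑ a, ∑ b, (P a i : ℂ) * P b j * A a b k = ∑ c, (P k c : ℂ) * B i j c := by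
    intro i j k
    exact_mod_cast h i j k
  set X : Fin 2 → ℂ := fun c => (∑ a, μ a * P a i) * N j c -
    ∑ l, ((B i j l : ℂ) * N l c - (B i l c : ℂ) * N j l - (B l j c : ℂ) * N i l) with hX
  have key : ∀ k, P k 0 * X 0 + P k 1 * X 1 = 0 := by
    intro k
    have e := fun a b => hM a b k
    simp only [hX, Fin.sum_univ_two] at e hN h' ⊢
    linear_combination (μ 0 * P 0 i + μ 1 * P 1 i) * hN j k
      - B i j 0 * hN 0 k - B i j 1 * hN 1 k
      + M 0 k * h' i j 0 + M 1 k * h' i j 1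
      - N j 0 * h' i 0 k - N j 1 * h' i 1 k
      - N i 0 * h' 0 j k - N i 1 * h' 1 j k
      + (P 0 i * A 0 0 k + P 1 i * A 1 0 k) * hN j 0 + (P 0 i * A 0 1 k + P 1 i * A 1 1 k) * hN j 1
      + (P 0 j * A 0 0 k + P 1 j * A 0 1 k) * hN i 0 + (P 0 j * A 1 0 k + P 1 j * A 1 1 k) * hN i 1
      + P 0 i * P 0 j * e 0 0 + P 0 i * P 1 j * e 0 1
      + P 1 i * P 0 j * e 1 0 + P 1 i * P 1 j * e 1 1
  have hd : (P 0 0 * P 1 1 - P 0 1 * P 1 0 : ℂ) ≠ 0 := by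
    rw [Matrix.det_fin_two] at hP
    exact_mod_cast hP
  have h0 : X 0 = 0 := by
    refine (mul_eq_zero.1 (?_ : (P 0 0 * P 1 1 - P 0 1 * P 1 0 : ℂ) * X 0 = 0)).resolve_left hd
    linear_combination (P 1 1 : ℂ) * key 0 - P 0 1 * key 1
  have h1 : X 1 = 0 := by
    refine (mul_eq_zero.1 (?_ : (P 0 0 * P 1 1 - P 0 1 * P 1 0 : ℂ) * X 1 = 0)).resolve_left hd
    linear_combination (P 0 0 : ℂ) * key 1 - P 1 0 * key 0
  exact Fin.forall_fin_two.2 ⟨sub_eq_zero.1 h0, sub_eq_zero.1 h1⟩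

theorem eq_model (B : TypeA) : B = model (B 0 0 0) (B 0 0 1) (B 0 1 0) (B 0 1 1)
    (B 1 0 0) (B 1 0 1) (B 1 1 0) (B 1 1 1) := by
  funext i j k
  fin_cases i <;> fin_cases j <;> fin_cases k <;> rfl

/-- If the first basis vector spans a two-sided ideal of the product `∇_a b`, the model is
listed. -/
theorem isListed_of_first_line {A B : TypeA} (hAB : A.LinEquiv B) (h₁ : B 0 0 1 = 0)
    (h₂ : B 0 1 1 = 0) (h₃ : B 1 0 1 = 0) : A.IsListed := by
  rw [eq_model B, h₁, h₂, h₃] at hAB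
  exact isListed_of_line hAB

theorem det_rotation_ne_zero {w : Fin 2 → ℝ} (hw : w ≠ 0) :
    (!![w 0, -w 1; w 1, w 0] : Matrix (Fin 2) (Fin 2) ℝ).det ≠ 0 := by
  intro h0
  rw [Matrix.det_fin_two_of] at h0
  refine hw (funext (Fin.forall_fin_two.2 ⟨?_, ?_⟩)) <;>
    exact mul_self_eq_zero.1 (by nlinarith [mul_self_nonneg (w 0), mul_self_nonneg (w 1)])

/-- If `w` spans a two-sided ideal of the product `∇_a b`, the model is listed. -/
theorem isListed_of_ideal {A₀ A : TypeA} (h : A₀.LinEquiv A) {w : Fin 2 → ℝ} (hw : w ≠ 0)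
    (hl : ∀ j, ∑ a, w a * (w 0 * A a j 1 - w 1 * A a j 0) = 0)
    (hr : ∀ j, ∑ a, w a * (w 0 * A j a 1 - w 1 * A j a 0) = 0) : A₀.IsListed := by
  have hd := det_rotation_ne_zero hw
  obtain ⟨B, hAB, hB⟩ := exists_linEquiv_of_basis A _ hd
  rw [Matrix.det_fin_two_of] at hd
  have e := fun i j => And.intro (hB i j 0) (hB i j 1)
  simp [Fin.forall_fin_two, Fin.sum_univ_two] at e hl hr
  refine isListed_of_first_line (h.trans hAB) ?_ ?_ ?_ <;>
  refine (mul_eq_zero.1 (?_ : (w 0 * w 0 - -w 1 * w 1) * _ = 0)).resolve_left hd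
  · linear_combination w 1 * e.1.1.1 - w 0 * e.1.1.2 + w 0 * hl.1 + w 1 * hl.2
  · linear_combination w 1 * e.1.2.1 - w 0 * e.1.2.2 - w 1 * hl.1 + w 0 * hl.2
  · linear_combination w 1 * e.2.1.1 - w 0 * e.2.1.2 - w 1 * hr.1 + w 0 * hr.2

/-- The joint eigenvectors with nonzero eigenvalue are the rank one matrices `μ ⊗ w`; this is how
they look in a new basis. -/
theorem TypeA.IsEigen.exists_of_basis {A B : TypeA} {P : Matrix (Fin 2) (Fin 2) ℝ}
    (hP : P.det ≠ 0) (h : ∀ i j k, ∑ a, ∑ b, P a i * P b j * A a b k = ∑ c, P k c * B i j c)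
    {μ : Fin 2 → ℂ} (hμ : μ ≠ 0) {w u : Fin 2 → ℂ} (hM : A.IsEigen μ fun j k => μ j * w k)
    (hu : ∀ k, ∑ c, (P k c : ℂ) * u c = w k) :
    ∃ ν : Fin 2 → ℂ, ν ≠ 0 ∧ B.IsEigen ν fun j k => ν j * u k := by
  refine ⟨fun i => ∑ a, μ a * P a i, fun h0 => hμ ?_, hM.of_basis hP h fun j k => ?_⟩
  · have hd : (P 0 0 * P 1 1 - P 0 1 * P 1 0 : ℂ) ≠ 0 := by
      rw [Matrix.det_fin_two] at hP
      exact_mod_cast hP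
    have e0 := congrFun h0 0
    have e1 := congrFun h0 1
    simp only [Fin.sum_univ_two, Pi.zero_apply] at e0 e1
    refine funext (Fin.forall_fin_two.2 ⟨?_, ?_⟩) <;>
    refine (mul_eq_zero.1 (?_ : (P 0 0 * P 1 1 - P 0 1 * P 1 0 : ℂ) * _ = 0)).resolve_left hd
    · linear_combination P 1 1 * e0 - P 1 0 * e1
    · linear_combination P 0 0 * e1 - P 0 1 * e0
  · have e := hu k
    simp only [Fin.sum_univ_two] at e ⊢
    linear_combination (μ 0 * P 0 j + μ 1 * P 1 j) * e

theorem fin_two_ne_zero {μ : Fin 2 → ℂ} (hμ : μ ≠ 0) : μ 0 ≠ 0 ∨ μ 1 ≠ 0 := by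
  by_contra! h
  exact hμ (funext (Fin.forall_fin_two.2 h))

/-- If `exp (μ₁ x¹ + μ₂ x²) w` is a complex Killing field with `w` real, then `w` spans a two-sided
ideal. -/
theorem isListed_of_real_direction {A : TypeA} {μ : Fin 2 → ℂ} (hμ : μ ≠ 0) {w : Fin 2 → ℝ}
    (hw : w ≠ 0) (h : A.IsEigen μ fun j k => μ j * w k) : A.IsListed := by
  have hd := det_rotation_ne_zero hw
  obtain ⟨B, hAB, hB⟩ := exists_linEquiv_of_basis A _ hd
  obtain ⟨ν, hν, hE⟩ := h.exists_of_basis hd hB hμ (u := ![1, 0]) (by simp [Fin.forall_fin_two])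
  simp [TypeA.IsEigen, Fin.forall_fin_two, Fin.sum_univ_two] at hE
  have hcase := fin_two_ne_zero hν
  have g : (B 0 0 1 : ℂ) = 0 ∧ (B 0 1 1 : ℂ) = 0 ∧ (B 1 0 1 : ℂ) = 0 := by
    grind
  exact isListed_of_first_line hAB (by exact_mod_cast g.1) (by exact_mod_cast g.2.1)
    (by exact_mod_cast g.2.2)

/-- The multiplication of `ℂ`, up to a nonzero factor `x + i y`, is the model `M56 0 0`. -/
theorem linEquiv_M56 {A : TypeA} {x y : ℝ} (hxy : x ^ 2 + y ^ 2 ≠ 0)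
    (h : A.LinEquiv (model (x / 2) (-y / 2) (y / 2) (x / 2) (y / 2) (x / 2) (-x / 2) (y / 2))) :
    A.LinEquiv (M56 0 0) := by
  refine h.trans (linEquiv_of_basis
    !![2 * x / (x ^ 2 + y ^ 2), 2 * y / (x ^ 2 + y ^ 2);
      2 * y / (x ^ 2 + y ^ 2), -2 * x / (x ^ 2 + y ^ 2)] ?_ ?_)
  · rw [Matrix.det_fin_two_of]
    have : 2 * x / (x ^ 2 + y ^ 2) * (-2 * x / (x ^ 2 + y ^ 2)) -
      2 * y / (x ^ 2 + y ^ 2) * (2 * y / (x ^ 2 + y ^ 2)) = -4 / (x ^ 2 + y ^ 2) := by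
      field_simp
      ring
    rw [this]
    exact div_ne_zero (by norm_num) hxy
  · simp [Fin.forall_fin_two, Fin.sum_univ_two, M56, model]
    refine ⟨⟨⟨?_, ?_⟩, ?_, ?_⟩, ⟨?_, ?_⟩, ?_, ?_⟩ <;> field_simp <;> ring

/-- If the complex field `exp (ν₁ x¹ + ν₂ x²) f`, with `f = ∂₁ + i ∂₂`, is Killing, then the product
`a ∘ b = ∇_a b` satisfies `f ∘ f = (x + i y) f` and `f ∘ f̄ = f̄ ∘ f = 0` for some `x + i y ≠ 0`. So it
is the multiplication of `ℂ`, up to a constant factor. -/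
theorem eq_complex_product {B : TypeA} {ν : Fin 2 → ℂ} (hν : ν ≠ 0)
    (hE : B.IsEigen ν fun j k => ν j * (![1, Complex.I] : Fin 2 → ℂ) k) :
    ∃ x y : ℝ, x ^ 2 + y ^ 2 ≠ 0 ∧
      B = model (x / 2) (-y / 2) (y / 2) (x / 2) (y / 2) (x / 2) (-x / 2) (y / 2) := by
  have hcase := fin_two_ne_zero hν
  have hI : Complex.I * Complex.I + 1 = 0 := by simp
  simp only [TypeA.IsEigen, Fin.forall_fin_two, Fin.sum_univ_two, Matrix.cons_val_zero,
    Matrix.cons_val_one] at hE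
  obtain ⟨⟨⟨h000, h001⟩, h010, h011⟩, ⟨h100, h101⟩, h110, h111⟩ := hE
  -- `l`, `m` are the values of `ν` on `f = (1, i)` and on its conjugate `g = (1, -i)`;
  -- `s`, `t`, `v`, `z` are the products `f ∘ f`, `g ∘ g`, `f ∘ g`, `g ∘ f`
  set j := Complex.I with hj
  obtain ⟨l, hl⟩ : ∃ l, l = ν 0 + j * ν 1 := ⟨_, rfl⟩
  obtain ⟨m, hm⟩ : ∃ m, m = ν 0 - j * ν 1 := ⟨_, rfl⟩
  obtain ⟨s, hs⟩ : ∃ s : Fin 2 → ℂ, ∀ k, s k = B 0 0 k - B 1 1 k + j * (B 0 1 k + B 1 0 k) :=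
    ⟨_, fun _ => rfl⟩
  obtain ⟨t, ht⟩ : ∃ s : Fin 2 → ℂ, ∀ k, s k = B 0 0 k - B 1 1 k - j * (B 0 1 k + B 1 0 k) :=
    ⟨_, fun _ => rfl⟩
  obtain ⟨v, hv⟩ : ∃ s : Fin 2 → ℂ, ∀ k, s k = B 0 0 k + B 1 1 k + j * (B 1 0 k - B 0 1 k) :=
    ⟨_, fun _ => rfl⟩
  obtain ⟨z, hz⟩ : ∃ s : Fin 2 → ℂ, ∀ k, s k = B 0 0 k + B 1 1 k + j * (B 0 1 k - B 1 0 k) :=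
    ⟨_, fun _ => rfl⟩
  have ff₀ : l ^ 2 - (s 0 * ν 0 + s 1 * ν 1) + 2 * l * s 0 = 0 := by
    simp only [hl, hs]
    linear_combination h000 + j * h010 + j * h100 + j * j * h110
      - (-(B 1 1 0 * ν 0 + B 1 1 1 * ν 1)
        + (ν 0 + j * ν 1) * B 1 1 0 + (ν 0 + j * ν 1) * B 1 1 0) * hI
  have ff₁ : j * l ^ 2 - j * (s 0 * ν 0 + s 1 * ν 1) + 2 * l * s 1 = 0 := by
    simp only [hl, hs]
    linear_combination h001 + j * h011 + j * h101 + j * j * h111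
      - (-(B 1 1 0 * ν 0 + B 1 1 1 * ν 1) * j
        + (ν 0 + j * ν 1) * B 1 1 1 + (ν 0 + j * ν 1) * B 1 1 1) * hI
  have gg₀ : m ^ 2 - (t 0 * ν 0 + t 1 * ν 1) + m * (z 0 + v 0) = 0 := by
    simp only [hm, ht, hz, hv]
    linear_combination h000 - j * h010 - j * h100 + j * j * h110
      - (-(B 1 1 0 * ν 0 + B 1 1 1 * ν 1)
        - (ν 0 - j * ν 1) * B 1 1 0 - (ν 0 - j * ν 1) * B 1 1 0) * hI
  have gg₁ : j * m ^ 2 - j * (t 0 * ν 0 + t 1 * ν 1) + m * (z 1 + v 1) = 0 := by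
    simp only [hm, ht, hz, hv]
    linear_combination h001 - j * h011 - j * h101 + j * j * h111
      - (-(B 1 1 0 * ν 0 + B 1 1 1 * ν 1) * j
        - (ν 0 - j * ν 1) * B 1 1 1 - (ν 0 - j * ν 1) * B 1 1 1) * hI
  have fg₀ : l * m - (v 0 * ν 0 + v 1 * ν 1) + m * s 0 + l * v 0 = 0 := by
    simp only [hl, hm, hs, hv]
    linear_combination h000 - j * h010 + j * h100 - j * j * h110
      - ((B 1 1 0 * ν 0 + B 1 1 1 * ν 1)
        + (ν 0 - j * ν 1) * B 1 1 0 - (ν 0 + j * ν 1) * B 1 1 0) * hI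
  have fg₁ : j * (l * m) - j * (v 0 * ν 0 + v 1 * ν 1) + m * s 1 + l * v 1 = 0 := by
    simp only [hl, hm, hs, hv]
    linear_combination h001 - j * h011 + j * h101 - j * j * h111
      - ((B 1 1 0 * ν 0 + B 1 1 1 * ν 1) * j
        + (ν 0 - j * ν 1) * B 1 1 1 - (ν 0 + j * ν 1) * B 1 1 1) * hI
  have gf₀ : l * m - (z 0 * ν 0 + z 1 * ν 1) + m * s 0 + l * z 0 = 0 := by
    simp only [hl, hm, hs, hz]
    linear_combination h000 + j * h010 - j * h100 - j * j * h110
      - ((B 1 1 0 * ν 0 + B 1 1 1 * ν 1)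
        - (ν 0 + j * ν 1) * B 1 1 0 + (ν 0 - j * ν 1) * B 1 1 0) * hI
  have gf₁ : j * (l * m) - j * (z 0 * ν 0 + z 1 * ν 1) + m * s 1 + l * z 1 = 0 := by
    simp only [hl, hm, hs, hz]
    linear_combination h001 + j * h011 - j * h101 - j * j * h111
      - ((B 1 1 0 * ν 0 + B 1 1 1 * ν 1) * j
        - (ν 0 + j * ν 1) * B 1 1 1 + (ν 0 - j * ν 1) * B 1 1 1) * hI
  -- complex conjugation exchanges `f` and `g`
  have conj_st : ∀ k, (starRingEnd ℂ) (s k) = t k := fun k => by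
    simp [hs, ht, hj]
    ring
  have conj_vz : ∀ k, (starRingEnd ℂ) (v k) = z k := fun k => by
    simp [hv, hz, hj]
    ring
  have conj₁ : s 0 + j * s 1 = 0 → t 0 - j * t 1 = 0 := fun h => by
    have h' := congrArg (starRingEnd ℂ) h
    simp [conj_st, hj] at h'
    rw [hj, ← h']
    ring
  have conj₂ : s 0 - j * s 1 = 0 → t 0 + j * t 1 = 0 := fun h => by
    have h' := congrArg (starRingEnd ℂ) h
    simp [conj_st, hj] at h'
    rw [hj, ← h']
  have conj₃ : v 0 + j * v 1 = 0 → z 0 - j * z 1 = 0 := fun h => by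
    have h' := congrArg (starRingEnd ℂ) h
    simp [conj_vz, hj] at h'
    rw [hj, ← h']
    ring
  have conj₄ : z 0 + j * z 1 = 0 → v 0 - j * v 1 = 0 := fun h => by
    have h' := congrArg (starRingEnd ℂ) h
    simp [← conj_vz, hj] at h'
    rw [hj, ← h']
    ring
  have hlm : l ≠ 0 ∨ m ≠ 0 := by
    by_contra! hc
    rw [hl, hm] at hc
    rcases hcase with h | h
    · exact h (by linear_combination (hc.1 + hc.2) / 2)
    · exact h (by linear_combination -j * (hc.1 - hc.2) / 2 + ν 1 * hI)
  -- components along `g` and along `f`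
  have ffg : l * (s 0 + j * s 1) = 0 := by
    linear_combination (ff₀ + j * ff₁) / 2 - (l ^ 2 - (s 0 * ν 0 + s 1 * ν 1)) / 2 * hI
  have ggg : m * (z 0 + j * z 1 + (v 0 + j * v 1)) = 0 := by
    linear_combination gg₀ + j * gg₁ - (m ^ 2 - (t 0 * ν 0 + t 1 * ν 1)) * hI
  have fgg : m * (s 0 + j * s 1) + l * (v 0 + j * v 1) = 0 := by
    linear_combination fg₀ + j * fg₁ - (l * m - (v 0 * ν 0 + v 1 * ν 1)) * hI
  have gfg : m * (s 0 + j * s 1) + l * (z 0 + j * z 1) = 0 := by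
    linear_combination gf₀ + j * gf₁ - (l * m - (z 0 * ν 0 + z 1 * ν 1)) * hI
  have dot : ∀ x : Fin 2 → ℂ,
      2 * (x 0 * ν 0 + x 1 * ν 1) = l * (x 0 - j * x 1) + m * (x 0 + j * x 1) := fun x => by
    rw [hl, hm]
    linear_combination 2 * x 1 * ν 1 * hI
  have fff : 2 * l ^ 2 + l * (s 0 - j * s 1) - m * (s 0 + j * s 1) = 0 := by
    linear_combination ff₀ - j * ff₁ + (l ^ 2 - (s 0 * ν 0 + s 1 * ν 1)) * hI + dot s
  have fgf : 2 * l * m + m * (s 0 - j * s 1) - m * (v 0 + j * v 1) = 0 := by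
    linear_combination fg₀ - j * fg₁ + (l * m - (v 0 * ν 0 + v 1 * ν 1)) * hI + dot v
  have gff : 2 * l * m + m * (s 0 - j * s 1) - m * (z 0 + j * z 1) = 0 := by
    linear_combination gf₀ - j * gf₁ + (l * m - (z 0 * ν 0 + z 1 * ν 1)) * hI + dot z
  have ggf : 2 * m ^ 2 + m * (z 0 - j * z 1 + (v 0 - j * v 1)) - l * (t 0 - j * t 1)
      - m * (t 0 + j * t 1) = 0 := by
    linear_combination gg₀ - j * gg₁ + (m ^ 2 - (t 0 * ν 0 + t 1 * ν 1)) * hI + dot t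
  have hl0 : l ≠ 0 := by
    intro h0
    have hm0 : m ≠ 0 := hlm.resolve_left (not_not.2 h0)
    rw [h0] at fgg fgf gff ggf
    have sp : s 0 + j * s 1 = 0 :=
      (mul_eq_zero.1 (by linear_combination fgg : m * _ = 0)).resolve_left hm0
    have vzp := (mul_eq_zero.1 ggg).resolve_left hm0
    have vp : v 0 + j * v 1 = 0 := by
      refine (mul_eq_zero.1 (?_ : m * _ = 0)).resolve_left hm0
      linear_combination (gff - fgf + m * vzp) / 2
    have sm : s 0 - j * s 1 = 0 := by
      refine (mul_eq_zero.1 (?_ : m * _ = 0)).resolve_left hm0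
      linear_combination fgf + m * vp
    have zm := conj₃ vp
    have vm := conj₄ (by linear_combination vzp - vp)
    have tp := conj₂ sm
    refine hm0 (pow_eq_zero_iff two_ne_zero |>.1 ?_)
    linear_combination (ggf - m * zm - m * vm + m * tp) / 2
  have sp := (mul_eq_zero.1 ffg).resolve_left hl0
  have vp : v 0 + j * v 1 = 0 :=
    (mul_eq_zero.1 (by linear_combination fgg - m * sp : l * _ = 0)).resolve_left hl0
  have zp : z 0 + j * z 1 = 0 :=
    (mul_eq_zero.1 (by linear_combination gfg - m * sp : l * _ = 0)).resolve_left hl0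
  have vm := conj₄ zp
  have sm : s 0 - j * s 1 = -2 * l := by
    refine mul_left_cancel₀ hl0 ?_
    linear_combination fff + m * sp
  have v0 : v 0 = 0 := by linear_combination (vp + vm) / 2
  have v1 : v 1 = 0 := by linear_combination -j * (vp - vm) / 2 + v 1 * hI
  have s0 : s 0 = -l := by linear_combination (sp + sm) / 2
  have s1 : s 1 = -j * l := by linear_combination -j * (sp - sm) / 2 + s 1 * hI
  refine ⟨-l.re, -l.im, fun h => hl0 ?_, ?_⟩
  · refine Complex.ext ?_ ?_ <;> exact pow_eq_zero_iff two_ne_zero |>.1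
      (by nlinarith [sq_nonneg l.re, sq_nonneg l.im])
  rw [hv] at v0 v1
  rw [hs] at s0 s1
  simp [Complex.ext_iff, hj] at v0 v1 s0 s1
  rw [eq_model B]
  congr 1 <;> linarith

/-- If `exp (μ₁ x¹ + μ₂ x²) w` is a complex Killing field and the real and imaginary parts of `w`
are linearly independent, then the product `∇_a b` is the multiplication of `ℂ`. -/
theorem isListed_of_complex_direction {A : TypeA} {μ : Fin 2 → ℂ} (hμ : μ ≠ 0) {w : Fin 2 → ℂ}
    (hw : (w 0).re * (w 1).im - (w 0).im * (w 1).re ≠ 0)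
    (h : A.IsEigen μ fun j k => μ j * w k) : A.IsListed := by
  have hd : (!![(w 0).re, (w 0).im; (w 1).re, (w 1).im] : Matrix (Fin 2) (Fin 2) ℝ).det ≠ 0 := by
    rwa [Matrix.det_fin_two_of]
  obtain ⟨B, hAB, hB⟩ := exists_linEquiv_of_basis A _ hd
  obtain ⟨ν, hν, hE⟩ := h.exists_of_basis hd hB hμ (u := ![1, Complex.I])
    (by simp [Fin.forall_fin_two])
  obtain ⟨x, y, hxy, rfl⟩ := eq_complex_product hν hE
  exact isListed_M56 (linEquiv_M56 hxy hAB)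

/-- A complex vector whose real and imaginary parts are dependent is a multiple of a real one. -/
theorem exists_real_multiple {w : Fin 2 → ℂ} (hw : w ≠ 0)
    (h : (w 0).re * (w 1).im - (w 0).im * (w 1).re = 0) :
    ∃ (ζ : ℂ) (u : Fin 2 → ℝ), ζ ≠ 0 ∧ u ≠ 0 ∧ ∀ k, w k = ζ * u k := by
  rcases eq_or_ne (w 0) 0 with h0 | h0
  · refine ⟨w 1, ![0, 1], (fin_two_ne_zero hw).resolve_left (not_not.2 h0), fun h1 => ?_, ?_⟩
    · simpa using congrFun h1 1
    · simp [Fin.forall_fin_two, h0]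
  · refine ⟨w 0, ![1, (w 1 / w 0).re], h0, fun h1 => ?_, ?_⟩
    · simpa using congrFun h1 0
    · have him : (w 1 / w 0).im = 0 := by
        rw [Complex.div_im, ← sub_div, div_eq_zero_iff]
        left
        linear_combination h
      have hre : (((w 1 / w 0).re : ℝ) : ℂ) = w 1 / w 0 := Complex.ext rfl (by simp [him])
      simp only [Fin.forall_fin_two, Matrix.cons_val_zero, Matrix.cons_val_one, hre]
      refine ⟨by simp, ?_⟩
      field_simp

/-- A joint eigenvector with eigenvalues that do not both vanish. -/
theorem isListed_of_isEigen {A : TypeA} {μ : Fin 2 → ℂ} (hμ : μ ≠ 0) {w : Fin 2 → ℂ} (hw : w ≠ 0)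
    (h : A.IsEigen μ fun j k => μ j * w k) : A.IsListed := by
  by_cases hd : (w 0).re * (w 1).im - (w 0).im * (w 1).re = 0
  · obtain ⟨ζ, u, hζ, hu, hwu⟩ := exists_real_multiple hw hd
    refine isListed_of_real_direction hμ hu fun i j k => mul_left_cancel₀ hζ ?_
    have e := h i j k
    simp only [hwu, Fin.sum_univ_two] at e ⊢
    linear_combination e
  · exact isListed_of_complex_direction hμ hd h

/-! ### Linear Killing fields -/

theorem hess_of_basis {A B : TypeA} {P : Matrix (Fin 2) (Fin 2) ℝ} (hP : P.det ≠ 0)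
    (h : ∀ i j k, ∑ a, ∑ b, P a i * P b j * A a b k = ∑ c, P k c * B i j c)
    {M N : Fin 2 → Fin 2 → ℝ} (hM : ∀ i, A.hess i M = 0)
    (hN : ∀ j k, ∑ c, P k c * N j c = ∑ b, P b j * M b k) (i : Fin 2) : B.hess i N = 0 := by
  have hE : A.IsEigen 0 fun j k => (M j k : ℂ) := by
    intro i j k
    have e := (congrFun (congrFun (hM i) j) k).symm
    rw [TypeA.hess_apply, Pi.zero_apply, Pi.zero_apply] at e
    simp only [Pi.zero_apply, zero_mul, Fin.sum_univ_two] at e ⊢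
    exact_mod_cast e
  have hE' := hE.of_basis hP h (N := fun j k => (N j k : ℂ)) (by exact_mod_cast hN)
  funext j k
  have e := hE' i j k
  simp only [Pi.zero_apply, zero_mul, Finset.sum_const_zero] at e
  rw [TypeA.hess_apply]
  exact_mod_cast e.symm

/-- The product `∇_a b` has a nonzero derivation which is upper triangular in the given basis. -/
theorem isListed_of_triangular {A B : TypeA} (hAB : A.LinEquiv B) {α β ε : ℝ}
    (h0 : ¬(α = 0 ∧ β = 0 ∧ ε = 0)) (h : ∀ i, B.hess i ![![α, 0], ![ε, β]] = 0) : A.IsListed := by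
  simp [funext_iff, Fin.forall_fin_two, TypeA.hess_apply, Fin.sum_univ_two] at h
  by_cases hline : B 0 0 1 = 0 ∧ B 0 1 1 = 0 ∧ B 1 0 1 = 0
  · exact isListed_of_first_line hAB hline.1 hline.2.1 hline.2.2
  obtain ⟨⟨⟨h1, h2⟩, h3, h4⟩, ⟨h5, h6⟩, h7, h8⟩ := h
  -- the other eigenvector `(ε, β - α)` spans a two-sided ideal
  rcases eq_or_ne α 0 with rfl | hα
  · have hβ : β ≠ 0 := by grind
    refine isListed_of_ideal hAB (w := ![ε, β]) (fun hw => hβ (congrFun hw 1)) ?_ ?_ <;>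
    · simp [Fin.forall_fin_two, Fin.sum_univ_two]
      grind
  · have hβ : β = 2 * α := by grind
    subst hβ
    obtain ⟨t, rfl⟩ : ∃ t, ε = t * α := ⟨ε / α, by field_simp⟩
    have e1 : B 0 0 0 = B 0 0 1 * t := mul_left_cancel₀ hα (by linear_combination -h1)
    have e2 : B 0 1 1 = -(B 0 0 1 * t) := mul_left_cancel₀ hα (by linear_combination -h4)
    have e3 : B 1 0 1 = -(B 0 0 1 * t) := mul_left_cancel₀ hα (by linear_combination -h6)
    rw [e1, e2] at h3
    rw [e1, e3] at h5
    rw [e2, e3] at h8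
    have e4 : B 0 1 0 = -(B 0 0 1 * t ^ 2) := mul_left_cancel₀ hα (by linear_combination -h3 / 2)
    have e5 : B 1 0 0 = -(B 0 0 1 * t ^ 2) := mul_left_cancel₀ hα (by linear_combination -h5 / 2)
    have e6 : B 1 1 1 = B 0 0 1 * t ^ 2 := mul_left_cancel₀ hα (by linear_combination -h8 / 2)
    rw [e4, e5, e6] at h7
    have e7 : B 1 1 0 = B 0 0 1 * t ^ 3 := mul_left_cancel₀ hα (by linear_combination -h7 / 3)
    refine isListed_of_ideal hAB (w := ![t, 1]) (fun hw => one_ne_zero (congrFun hw 1)) ?_ ?_ <;>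
    · simp [Fin.forall_fin_two, Fin.sum_univ_two, e1, e2, e3, e4, e5, e6, e7]
      constructor <;> ring

/-- If the product `∇_a b` has a nonzero derivation that commutes with the rotation by a right
angle, then it vanishes: the eigenvalues of the derivation are `z = x + i y` and its conjugate, and
neither of them is the sum of two of them. -/
theorem eq_zero_of_rotation {B : TypeA} {x y : ℝ} (h0 : x ^ 2 + y ^ 2 ≠ 0)
    (h : ∀ i, B.hess i ![![x, -y], ![y, x]] = 0) : B = 0 := by
  simp [funext_iff, Fin.forall_fin_two, TypeA.hess_apply, Fin.sum_univ_two] at h ⊢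
  have h9 : x ^ 2 + 9 * y ^ 2 ≠ 0 := by
    intro h'
    exact h0 (by nlinarith [sq_nonneg x, sq_nonneg y])
  obtain ⟨⟨⟨h1, h2⟩, h3, h4⟩, ⟨h5, h6⟩, h7, h8⟩ := h
  have cancel : ∀ {c t : ℝ}, c ≠ 0 → c * t = 0 → t = 0 := fun hc h =>
    (mul_eq_zero.1 h).resolve_left hc
  have e1 : B 0 0 0 + B 1 1 0 = 0 := cancel h0 (by grind)
  have e2 : B 0 0 1 + B 1 1 1 = 0 := cancel h0 (by grind)
  have e3 : B 1 0 0 - B 0 1 0 = 0 := cancel h0 (by grind)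
  have e4 : B 1 0 1 - B 0 1 1 = 0 := cancel h0 (by grind)
  have e5 : B 0 0 0 - B 1 1 0 + (B 0 1 1 + B 1 0 1) = 0 := cancel h0 (by grind)
  have e6 : B 0 0 1 - B 1 1 1 - (B 0 1 0 + B 1 0 0) = 0 := cancel h0 (by grind)
  have e7 : B 0 0 0 - B 1 1 0 - (B 0 1 1 + B 1 0 1) = 0 := cancel h9 (by grind)
  have e8 : B 0 0 1 - B 1 1 1 + (B 0 1 0 + B 1 0 0) = 0 := cancel h9 (by grind)
  refine ⟨⟨⟨?_, ?_⟩, ?_, ?_⟩, ⟨?_, ?_⟩, ?_, ?_⟩ <;> linarith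

/-- A linear Killing field `x ↦ N x` is a derivation of the product `∇_a b`. -/
theorem isListed_of_derivation {A : TypeA} {N : Fin 2 → Fin 2 → ℝ} (hN : N ≠ 0)
    (h : ∀ i, A.hess i N = 0) : A.IsListed := by
  obtain ⟨z, hz⟩ := Module.End.exists_eigenvalue
    (Matrix.toLin' (Matrix.of fun k j => (N j k : ℂ)))
  obtain ⟨f, hf⟩ := hz.exists_hasEigenvector
  have hfz : ∀ k, f 0 * N 0 k + f 1 * N 1 k = z * f k := by
    intro k
    have e := congrFun hf.apply_eq_smul k
    simp [Matrix.mulVec, dotProduct, Fin.sum_univ_two] at e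
    linear_combination e
  have hf0 : f ≠ 0 := hf.2
  by_cases hd : (f 0).re * (f 1).im - (f 0).im * (f 1).re = 0
  · obtain ⟨ζ, w, hζ, hw, hfw⟩ := exists_real_multiple hf0 hd
    have hwz : ∀ k, (w 0 * N 0 k + w 1 * N 1 k : ℂ) = z * w k := by
      intro k
      refine mul_left_cancel₀ hζ ?_
      have e := hfz k
      simp only [hfw] at e
      linear_combination e
    have hre : ∀ k, w 0 * N 0 k + w 1 * N 1 k = z.re * w k := by
      intro k
      simpa using congrArg Complex.re (hwz k)
    have hdet := det_rotation_ne_zero hw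
    obtain ⟨B, hAB, hB⟩ := exists_linEquiv_of_basis A _ hdet
    rw [Matrix.det_fin_two_of] at hdet
    have hn : w 0 ^ 2 + w 1 ^ 2 ≠ 0 := by
      convert hdet using 1
      ring
    -- the second row of the derivation in the basis `w`, `w^⊥`
    set y : Fin 2 → ℝ := fun k => -w 1 * N 0 k + w 0 * N 1 k with hy
    set β := (-w 1 * y 0 + w 0 * y 1) / (w 0 ^ 2 + w 1 ^ 2) with hβ
    set ε := (w 0 * y 0 + w 1 * y 1) / (w 0 ^ 2 + w 1 ^ 2) with hε
    have hy0 : w 0 * ε - w 1 * β = y 0 := by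
      rw [hβ, hε]
      field_simp
      ring
    have hy1 : w 1 * ε + w 0 * β = y 1 := by
      rw [hβ, hε]
      field_simp
      ring
    clear_value β ε
    refine isListed_of_triangular hAB (α := z.re) (β := β) (ε := ε) ?_
      (hess_of_basis (det_rotation_ne_zero hw) hB h ?_)
    · rintro ⟨h1, rfl, rfl⟩
      have e : ∀ k, w 0 * N 0 k + w 1 * N 1 k = 0 ∧ -w 1 * N 0 k + w 0 * N 1 k = 0 := by
        refine fun k => ⟨by rw [hre, h1, zero_mul], ?_⟩
        change y k = 0
        revert k
        rw [Fin.forall_fin_two, ← hy0, ← hy1]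
        simp
      refine hN (funext (Fin.forall_fin_two.2 ⟨funext fun k => ?_, funext fun k => ?_⟩)) <;>
      refine (mul_eq_zero.1 (?_ : (w 0 ^ 2 + w 1 ^ 2) * _ = 0)).resolve_left hn
      · linear_combination w 0 * (e k).1 - w 1 * (e k).2
      · linear_combination w 1 * (e k).1 + w 0 * (e k).2
    · have e0 := hre 0
      have e1 := hre 1
      simp only [hy] at hy0 hy1
      simp [Fin.forall_fin_two, Fin.sum_univ_two]
      refine ⟨⟨?_, ?_⟩, ?_, ?_⟩ <;> linarith
  · have hdet :
        (!![(f 0).re, (f 0).im; (f 1).re, (f 1).im] : Matrix (Fin 2) (Fin 2) ℝ).det ≠ 0 := by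
      rwa [Matrix.det_fin_two_of]
    obtain ⟨B, hAB, hB⟩ := exists_linEquiv_of_basis A _ hdet
    have hre : ∀ k, (f 0).re * N 0 k + (f 1).re * N 1 k = z.re * (f k).re - z.im * (f k).im := by
      intro k
      simpa using congrArg Complex.re (hfz k)
    have him : ∀ k, (f 0).im * N 0 k + (f 1).im * N 1 k = z.re * (f k).im + z.im * (f k).re := by
      intro k
      simpa using congrArg Complex.im (hfz k)
    have hz0 : z.re ^ 2 + z.im ^ 2 ≠ 0 := by
      intro h0
      have h1 : z.re = 0 := pow_eq_zero_iff two_ne_zero |>.1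
        (by nlinarith [sq_nonneg z.re, sq_nonneg z.im])
      have h2 : z.im = 0 := pow_eq_zero_iff two_ne_zero |>.1
        (by nlinarith [sq_nonneg z.re, sq_nonneg z.im])
      refine hN (funext (Fin.forall_fin_two.2 ⟨funext fun k => ?_, funext fun k => ?_⟩)) <;>
      refine (mul_eq_zero.1
        (?_ : ((f 0).re * (f 1).im - (f 0).im * (f 1).re) * _ = 0)).resolve_left hd
      · have e0 := hre k
        have e1 := him k
        rw [h1, h2] at e0 e1
        linear_combination (f 1).im * e0 - (f 1).re * e1
      · have e0 := hre k
        have e1 := him k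
        rw [h1, h2] at e0 e1
        linear_combination (f 0).re * e1 - (f 0).im * e0
    have hB0 : B = 0 := by
      refine eq_zero_of_rotation hz0 (hess_of_basis hdet hB h ?_)
      have e0 := Fin.forall_fin_two.1 hre
      have e1 := Fin.forall_fin_two.1 him
      simp [Fin.forall_fin_two, Fin.sum_univ_two]
      refine ⟨⟨?_, ?_⟩, ?_, ?_⟩ <;> linarith
    subst hB0
    exact isListed_of_first_line hAB rfl rfl rfl

/-! ### Existence of a joint eigenvector -/

theorem exists_eigenvector_mem {V : Type*} [AddCommGroup V] [Module ℂ V] [FiniteDimensional ℂ V]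
    {E : Submodule ℂ V} (hE : E ≠ ⊥) {f : Module.End ℂ V} (hf : ∀ x ∈ E, f x ∈ E) :
    ∃ (a : ℂ) (x : V), x ∈ E ∧ x ≠ 0 ∧ f x = a • x := by
  have : Nontrivial E := (Submodule.nontrivial_iff_ne_bot).2 hE
  obtain ⟨a, ha⟩ := Module.End.exists_eigenvalue (f.restrict hf)
  obtain ⟨x, hx⟩ := ha.exists_hasEigenvector
  exact ⟨a, x, x.2, fun h => hx.2 (Subtype.ext h), congrArg Subtype.val hx.apply_eq_smul⟩

theorem exists_joint_eigenvector {V : Type*} [AddCommGroup V] [Module ℂ V] [FiniteDimensional ℂ V]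
    {E : Submodule ℂ V} (hE : E ≠ ⊥) {f g : Module.End ℂ V} (hf : ∀ x ∈ E, f x ∈ E)
    (hg : ∀ x ∈ E, g x ∈ E) (hfg : ∀ x ∈ E, f (g x) = g (f x)) :
    ∃ (a b : ℂ) (x : V), x ∈ E ∧ x ≠ 0 ∧ f x = a • x ∧ g x = b • x := by
  obtain ⟨a, x, hx, hx0, hfx⟩ := exists_eigenvector_mem hE hf
  have hE' : E ⊓ f.eigenspace a ≠ ⊥ := fun h =>
    hx0 ((Submodule.eq_bot_iff _).1 h x ⟨hx, Module.End.mem_eigenspace_iff.2 hfx⟩)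
  obtain ⟨b, y, hy, hy0, hgy⟩ := exists_eigenvector_mem hE' (f := g) fun y hy =>
    ⟨hg y hy.1, Module.End.mem_eigenspace_iff.2 (by
      rw [hfg y hy.1, Module.End.mem_eigenspace_iff.1 hy.2, map_smul])⟩
  exact ⟨a, b, y, hy.1, hy0, Module.End.mem_eigenspace_iff.1 hy.2, hgy⟩

/-- The complexification of `A.hess i`. -/
noncomputable def TypeA.complexHess (A : TypeA) (i : Fin 2) :
    Module.End ℂ (Fin 2 → Fin 2 → ℂ) where
  toFun M := fun j k =>
    ∑ l, ((A i j l : ℂ) * M l k - (A i l k : ℂ) * M j l - (A l j k : ℂ) * M i l)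
  map_add' M N := by
    funext j k
    simp only [Fin.sum_univ_two, Pi.add_apply]
    ring
  map_smul' c M := by
    funext j k
    simp only [Fin.sum_univ_two, Pi.smul_apply, smul_eq_mul, RingHom.id_apply]
    ring

theorem re_complexHess (A : TypeA) (i : Fin 2) (M : Fin 2 → Fin 2 → ℂ) :
    (fun j k => (A.complexHess i M j k).re) = A.hess i fun j k => (M j k).re := by
  funext j k
  simp [TypeA.complexHess, TypeA.hess_apply]

theorem im_complexHess (A : TypeA) (i : Fin 2) (M : Fin 2 → Fin 2 → ℂ) :
    (fun j k => (A.complexHess i M j k).im) = A.hess i fun j k => (M j k).im := by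
  funext j k
  simp [TypeA.complexHess, TypeA.hess_apply]

/-- The complexification of the isotropy representation. -/
noncomputable def TypeA.complexIsotropy (A : TypeA) : Submodule ℂ (Fin 2 → Fin 2 → ℂ) where
  carrier := {M | (fun j k => (M j k).re) ∈ A.isotropy ∧ (fun j k => (M j k).im) ∈ A.isotropy}
  zero_mem' := ⟨A.isotropy.zero_mem, A.isotropy.zero_mem⟩
  add_mem' hM hN := ⟨A.isotropy.add_mem hM.1 hN.1, A.isotropy.add_mem hM.2 hN.2⟩
  smul_mem' c M hM := by
    constructor
    · convert A.isotropy.sub_mem (A.isotropy.smul_mem c.re hM.1) (A.isotropy.smul_mem c.im hM.2)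
        using 1
      funext j k
      simp
    · convert A.isotropy.add_mem (A.isotropy.smul_mem c.re hM.2) (A.isotropy.smul_mem c.im hM.1)
        using 1
      funext j k
      simp

/-- Equality of complex Jacobians can be tested on real and imaginary parts. -/
theorem complex_jacobian_ext {M N : Fin 2 → Fin 2 → ℂ}
    (h₁ : (fun j k => (M j k).re) = fun j k => (N j k).re)
    (h₂ : (fun j k => (M j k).im) = fun j k => (N j k).im) : M = N := by
  funext j k
  exact Complex.ext (congrFun (congrFun h₁ j) k) (congrFun (congrFun h₂ j) k)

theorem isListed_of_isotropy {A : TypeA} {M : Fin 2 → Fin 2 → ℝ} (hM : M ∈ A.isotropy)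
    (hM0 : M ≠ 0) : A.IsListed := by
  have hE : A.complexIsotropy ≠ ⊥ := by
    intro h
    have hmem : (fun j k => (M j k : ℂ)) ∈ A.complexIsotropy :=
      ⟨hM, A.isotropy.zero_mem⟩
    have e := (Submodule.eq_bot_iff _).1 h _ hmem
    refine hM0 (funext fun j => funext fun k => ?_)
    exact Complex.ofReal_eq_zero.1 (congrFun (congrFun e j) k)
  have hinv : ∀ i, ∀ N ∈ A.complexIsotropy, A.complexHess i N ∈ A.complexIsotropy := fun i N hN =>
    ⟨by rw [re_complexHess]; exact hess_mem_isotropy hN.1 i,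
      by rw [im_complexHess]; exact hess_mem_isotropy hN.2 i⟩
  have hcomm : ∀ N ∈ A.complexIsotropy,
      A.complexHess 0 (A.complexHess 1 N) = A.complexHess 1 (A.complexHess 0 N) := by
    intro N hN
    refine complex_jacobian_ext ?_ ?_
    · simp only [re_complexHess]
      exact isotropy_comm hN.1 0 1
    · simp only [im_complexHess]
      exact isotropy_comm hN.2 0 1
  obtain ⟨a, b, N, hN, hN0, hNa, hNb⟩ := exists_joint_eigenvector hE (hinv 0) (hinv 1) hcomm
  set μ : Fin 2 → ℂ := ![a, b] with hμ
  have hEig : ∀ i, A.complexHess i N = μ i • N := Fin.forall_fin_two.2 ⟨hNa, hNb⟩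
  rcases eq_or_ne μ 0 with h0 | h0
  · have hre : ∀ i, (A.hess i fun j k => (N j k).re) = 0 := by
      intro i
      rw [← re_complexHess, hEig, h0]
      funext j k
      simp
    have him : ∀ i, (A.hess i fun j k => (N j k).im) = 0 := by
      intro i
      rw [← im_complexHess, hEig, h0]
      funext j k
      simp
    by_cases hr : (fun j k => (N j k).re) = 0
    · exact isListed_of_derivation (fun hi => hN0 (complex_jacobian_ext hr hi)) him
    · exact isListed_of_derivation hr hre
  · -- the torsion constraint makes the eigenvector a matrix of rank one
    have hsymm : ∀ i j k, μ i * N j k = μ j * N i k := by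
      intro i j k
      have e : A.complexHess i N j k = A.complexHess j N i k := by
        refine Complex.ext ?_ ?_
        · have := congrFun (congrFun (re_complexHess A i N) j) k
          have := congrFun (congrFun (re_complexHess A j N) i) k
          have := isotropy_symm hN.1 i j k
          simp_all
        · have := congrFun (congrFun (im_complexHess A i N) j) k
          have := congrFun (congrFun (im_complexHess A j N) i) k
          have := isotropy_symm hN.2 i j k
          simp_all
      rw [hEig, hEig] at e
      exact e
    obtain ⟨i, hi⟩ : ∃ i, μ i ≠ 0 := Function.ne_iff.1 h0
    have hrank : N = fun j k => μ j * (N i k / μ i) := by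
      funext j k
      rw [← mul_div_assoc, ← hsymm i j k, mul_div_cancel_left₀ _ hi]
    refine isListed_of_isEigen h0 (w := fun k => N i k / μ i) (fun hw => hN0 ?_) ?_
    · rw [hrank]
      funext j k
      rw [show N i k / μ i = 0 from congrFun hw k, mul_zero]
      rfl
    · rw [← hrank]
      exact fun i j k => (congrFun (congrFun (hEig i) j) k).symm

/-- A Killing algebra of dimension greater than two contains a field with nonzero Jacobian. -/
theorem exists_isotropy_ne_zero {A : TypeA} (h : 2 < Module.rank ℝ A.killing) :
    ∃ M ∈ A.isotropy, M ≠ 0 := by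
  by_contra! h0
  let ev : A.killing →ₗ[ℝ] Plane :=
    { toFun := fun v => v.1 0
      map_add' := fun _ _ => rfl
      map_smul' := fun _ _ => rfl }
  have hinj : Function.Injective ev := by
    refine (injective_iff_map_eq_zero ev).2 fun v hv => Subtype.ext ?_
    exact eq_zero_of_jet v.2 hv (h0 _ (jac_mem_isotropy v.2))
  have hle := LinearMap.rank_le_of_injective ev hinj
  rw [rank_fin_fun] at hle
  exact absurd h (not_lt.2 (by exact_mod_cast hle))

theorem isListed_of_rank {A : TypeA} (h : 2 < Module.rank ℝ A.killing) : A.IsListed :=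
  let ⟨_, hM, hM0⟩ := exists_isotropy_ne_zero h
  isListed_of_isotropy hM hM0

end AffineKilling

open AffineKilling in
theorem lemma3p2 :
    -- classification of the Type A models with more than two Killing fields
    (∀ A : AffineKilling.TypeA, 2 < Module.rank ℝ A.killing →
      (∃ T₁ T₂ : ℝ, A.LinEquiv (AffineKilling.M06 T₁ T₂)) ∨
      (∃ T₁ T₂ : ℝ, T₁ = 0 ∧ A.LinEquiv (AffineKilling.M16 T₁ T₂)) ∨
      (∃ T₁ T₂ : ℝ, T₁ * T₂ = 0 ∧ A.LinEquiv (AffineKilling.M26 T₁ T₂)) ∨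
      (∃ T₁ T₂ : ℝ, T₁ * T₂ = 0 ∧ A.LinEquiv (AffineKilling.M36 T₁ T₂)) ∨
      (∃ T₁ T₂ : ℝ, T₂ = 0 ∧ A.LinEquiv (AffineKilling.M46 T₁ T₂)) ∨
      (∃ T₁ T₂ : ℝ, T₁ = 0 ∧ T₂ = 0 ∧ A.LinEquiv (AffineKilling.M56 T₁ T₂)) ∨
      (∃ T₁ T₂ : ℝ, T₂ = 0 ∧ A.LinEquiv (AffineKilling.M14 T₁ T₂)) ∨
      (∃ c T₁ T₂ : ℝ, c ≠ 0 ∧ c ≠ -1 ∧ T₂ = 0 ∧ A.LinEquiv (AffineKilling.M24 c T₁ T₂)) ∨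
      (∃ c T₁ T₂ : ℝ, c ≠ 0 ∧ c ≠ -1 ∧ T₂ = 0 ∧ A.LinEquiv (AffineKilling.M34 c T₁ T₂)) ∨
      (∃ c T₁ T₂ : ℝ, T₂ = 0 ∧ A.LinEquiv (AffineKilling.M44 c T₁ T₂)) ∨
      (∃ c T₁ T₂ : ℝ, T₂ = 0 ∧ A.LinEquiv (AffineKilling.M54 c T₁ T₂))) ∧
    -- the family M06
    ((AffineKilling.M06 0 0).HasKillingBasis
      ![AffineKilling.d₁, AffineKilling.d₂,
        AffineKilling.vf fun x _ => (x, 0), AffineKilling.vf fun x _ => (0, x),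
        AffineKilling.vf fun _ y => (y, 0), AffineKilling.vf fun _ y => (0, y)]) ∧
    (∀ T₁ T₂ : ℝ, (T₁, T₂) ≠ (0, 0) → (AffineKilling.M06 T₁ T₂).HasKillingBasis
      ![AffineKilling.d₁, AffineKilling.d₂,
        AffineKilling.vf fun x _ => (x * T₁, x * T₂),
        AffineKilling.vf fun _ y => (y * T₁, y * T₂)]) ∧
    -- the family M16
    ((AffineKilling.M16 0 0).HasKillingBasis
      ![AffineKilling.d₁,
        AffineKilling.vf fun x y => (Real.exp (-x), -(Real.exp (-x) * y)),
        AffineKilling.vf fun _ y => (0, y),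
        AffineKilling.vf fun _ y => (y, -y ^ 2),
        AffineKilling.d₂,
        AffineKilling.vf fun x _ => (0, Real.exp (-x))]) ∧
    (∀ T₂ : ℝ, T₂ ≠ 0 → (AffineKilling.M16 0 T₂).HasKillingBasis
      ![AffineKilling.d₁, AffineKilling.d₂,
        AffineKilling.vf fun _ y => (0, y),
        AffineKilling.vf fun x _ => (0, Real.exp (-x))]) ∧
    (∀ T₁ T₂ : ℝ, T₁ ≠ 0 → (AffineKilling.M16 T₁ T₂).OnlyTranslations) ∧
    -- the family M26
    ((AffineKilling.M26 0 0).HasKillingBasis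
      ![AffineKilling.d₁,
        AffineKilling.vf fun x _ => (Real.exp x, 0),
        AffineKilling.vf fun x y => (Real.exp (x + y), 0),
        AffineKilling.d₂,
        AffineKilling.vf fun x y => (0, Real.exp (-x - y)),
        AffineKilling.vf fun _ y => (0, Real.exp (-y))]) ∧
    (∀ T₂ : ℝ, T₂ ≠ 0 → (AffineKilling.M26 0 T₂).HasKillingBasis
      ![AffineKilling.d₁, AffineKilling.d₂,
        AffineKilling.vf fun x y => (0, Real.exp (-x - y)),
        AffineKilling.vf fun _ y => (0, Real.exp (-y))]) ∧
    (∀ T₁ : ℝ, T₁ ≠ 0 → (AffineKilling.M26 T₁ 0).HasKillingBasis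
      ![AffineKilling.d₁,
        AffineKilling.vf fun x _ => (Real.exp x, 0),
        AffineKilling.vf fun x y => (Real.exp (x + y), 0),
        AffineKilling.d₂]) ∧
    (∀ T₁ T₂ : ℝ, T₁ * T₂ ≠ 0 → (AffineKilling.M26 T₁ T₂).OnlyTranslations) ∧
    -- the family M36
    ((AffineKilling.M36 0 0).HasKillingBasis
      ![AffineKilling.d₁,
        AffineKilling.vf fun x _ => (x, 0),
        AffineKilling.vf fun _ y => (Real.exp y, 0),
        AffineKilling.d₂,
        AffineKilling.vf fun _ y => (0, Real.exp (-y)),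
        AffineKilling.vf fun x y => (0, x * Real.exp (-y))]) ∧
    (∀ T₂ : ℝ, T₂ ≠ 0 → (AffineKilling.M36 0 T₂).HasKillingBasis
      ![AffineKilling.d₁, AffineKilling.d₂,
        AffineKilling.vf fun _ y => (0, Real.exp (-y)),
        AffineKilling.vf fun x y => (0, x * Real.exp (-y))]) ∧
    (∀ T₁ : ℝ, T₁ ≠ 0 → (AffineKilling.M36 T₁ 0).HasKillingBasis
      ![AffineKilling.d₁, AffineKilling.d₂,
        AffineKilling.vf fun x _ => (x, 0),
        AffineKilling.vf fun _ y => (Real.exp y, 0)]) ∧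
    (∀ T₁ T₂ : ℝ, T₁ * T₂ ≠ 0 → (AffineKilling.M36 T₁ T₂).OnlyTranslations) ∧
    -- the family M46
    ((AffineKilling.M46 0 0).HasKillingBasis
      ![AffineKilling.d₁, AffineKilling.d₂,
        AffineKilling.vf fun x y => (x + 1 / 2 * y ^ 2, 0),
        AffineKilling.vf fun _ y => (y, 0),
        AffineKilling.vf fun x y => (-(x * y) - 1 / 2 * y ^ 3, x + 1 / 2 * y ^ 2),
        AffineKilling.vf fun _ y => (-y ^ 2, y)]) ∧
    (∀ T₁ : ℝ, T₁ ≠ 0 → (AffineKilling.M46 T₁ 0).HasKillingBasis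
      ![AffineKilling.d₁, AffineKilling.d₂,
        AffineKilling.vf fun x y => (x + 1 / 2 * y ^ 2, 0),
        AffineKilling.vf fun _ y => (y, 0)]) ∧
    (∀ T₁ T₂ : ℝ, T₂ ≠ 0 → (AffineKilling.M46 T₁ T₂).OnlyTranslations) ∧
    -- the family M56
    ((AffineKilling.M56 0 0).HasKillingBasis
      ![AffineKilling.d₁, AffineKilling.d₂,
        AffineKilling.vf fun _ y => (Real.cos (2 * y), -Real.sin (2 * y)),
        AffineKilling.vf fun _ y => (Real.sin (2 * y), Real.cos (2 * y)),
        AffineKilling.vf fun x y => (Real.exp (-x) * Real.cos y, -(Real.exp (-x) * Real.sin y)),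
        AffineKilling.vf fun x y => (Real.exp (-x) * Real.sin y, Real.exp (-x) * Real.cos y)]) ∧
    (∀ T₁ T₂ : ℝ, (T₁, T₂) ≠ (0, 0) → (AffineKilling.M56 T₁ T₂).OnlyTranslations) ∧
    -- the family M14
    (∀ T₁ : ℝ, (AffineKilling.M14 T₁ 0).HasKillingBasis
      ![AffineKilling.d₁, AffineKilling.d₂,
        AffineKilling.vf fun x _ => (Real.exp x, 0),
        AffineKilling.vf fun x y => (y * Real.exp x, 0)]) ∧
    (∀ T₁ T₂ : ℝ, T₂ ≠ 0 → (AffineKilling.M14 T₁ T₂).OnlyTranslations) ∧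
    -- the family M24
    (∀ c T₁ : ℝ, c ≠ 0 → c ≠ -1 → (AffineKilling.M24 c T₁ 0).HasKillingBasis
      ![AffineKilling.d₁, AffineKilling.d₂,
        AffineKilling.vf fun x _ => (Real.exp x, 0),
        AffineKilling.vf fun x y => (Real.exp (x + y), 0)]) ∧
    (∀ c T₁ T₂ : ℝ, c ≠ 0 → c ≠ -1 → T₂ ≠ 0 → (AffineKilling.M24 c T₁ T₂).OnlyTranslations) ∧
    -- the family M34
    (∀ c T₁ : ℝ, c ≠ 0 → c ≠ -1 → (AffineKilling.M34 c T₁ 0).HasKillingBasis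
      ![AffineKilling.d₁, AffineKilling.d₂,
        AffineKilling.vf fun _ y => (Real.exp y, 0),
        AffineKilling.vf fun x _ => (x, 0)]) ∧
    (∀ c T₁ T₂ : ℝ, c ≠ 0 → c ≠ -1 → T₂ ≠ 0 → (AffineKilling.M34 c T₁ T₂).OnlyTranslations) ∧
    -- the family M44
    (∀ c T₁ : ℝ, (AffineKilling.M44 c T₁ 0).HasKillingBasis
      ![AffineKilling.d₁, AffineKilling.d₂,
        AffineKilling.vf fun x y => (x + c / 2 * y ^ 2, 0),
        AffineKilling.vf fun _ y => (y, 0)]) ∧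
    (∀ c T₁ T₂ : ℝ, T₂ ≠ 0 → (AffineKilling.M44 c T₁ T₂).OnlyTranslations) ∧
    -- the family M54
    (∀ c T₁ : ℝ, (AffineKilling.M54 c T₁ 0).HasKillingBasis
      ![AffineKilling.d₁, AffineKilling.d₂,
        AffineKilling.vf fun x y => (Real.exp (-x + c * y) * Real.cos y, 0),
        AffineKilling.vf fun x y => (Real.exp (-x + c * y) * Real.sin y, 0)]) ∧
    (∀ c T₁ T₂ : ℝ, T₂ ≠ 0 → (AffineKilling.M54 c T₁ T₂).OnlyTranslations) := by
  exact ⟨fun _ hA => isListed_of_rank hA,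
    M06_basis_zero, fun _ _ => M06_basis,
    M16_basis_zero, fun _ => M16_basis, fun _ T₂ => M16_onlyTranslations T₂,
    M26_basis_zero, fun _ => M26_basis_left, fun _ => M26_basis_right,
    fun _ _ => M26_onlyTranslations,
    M36_basis_zero, fun _ => M36_basis_left, fun _ => M36_basis_right,
    fun _ _ => M36_onlyTranslations,
    M46_basis_zero, fun _ => M46_basis, fun T₁ _ => M46_onlyTranslations T₁,
    M56_basis_zero, fun _ _ => M56_onlyTranslations,
    M14_basis, fun T₁ _ => M14_onlyTranslations T₁,
    fun _ T₁ hc₀ hc₁ => M24_basis hc₀ hc₁ T₁,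
    fun _ T₁ _ hc₀ hc₁ => M24_onlyTranslations hc₀ hc₁ T₁,
    fun _ T₁ hc₀ hc₁ => M34_basis hc₀ hc₁ T₁,
    fun _ T₁ _ hc₀ _ => M34_onlyTranslations hc₀ T₁,
    M44_basis, fun c T₁ _ => M44_onlyTranslations c T₁,
    M54_basis, fun c T₁ _ => M54_onlyTranslations c T₁⟩
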